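/- Let $\mu$ be a Borel probability measure with infinite support on the unit circle $\mathbb{T}=\{z\in\mathbb{C}:|z|=1\}$, and let $(x_n)_{n\ge 0}$ be a sequence of orthonormal Laurent polynomials for $\mu$ obtained by orthonormalizing $1,z^{-1},z,z^{-2},z^{2},\dots$ in $L^2(\mu)$. That is, $x_n$ lies in the span of the first $n+1$ of these powers for every $n$, and $\int_{\mathbb{T}} x_m\,\overline{x_n}\,d\mu=\delta_{mn}$ for all $m,n\ge 0$. By a linear differential operator of order $r$ on $\mathbb{C}[z,z^{-1}]$ we mean a linear map $D:\mathbb{C}[z,z^{-1}]\to\mathbb{C}[z,z^{-1}]$ of the form $D=\sum_{k=0}^{r}D_k(z)\frac{d^k}{dz^k}$, where the $D_k$ are functions on $\mathbb{C}\setminus\{0\}$ and $D_r$ is not identically zero. Then the following are equivalent: 1. There are an integer $r\ge 1$, a linear differential operator $D$ of order $r$ on $\mathbb{C}[z,z^{-1}]$ and an $n_0\in\mathbb{N}$ such that $$D x_n\in\operatorname{span}\{x_{n-1},x_n,x_{n+1}\}\qquad\text{for all } n\ge n_0,$$ where $x_{-1}:=0$. 2. The $x_n$ are orthonormal with respect to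 the normalized Lebesgue measure $\frac{d\theta}{2\pi}$ on $\mathbb{T}$. -/

import Mathlib

open MeasureTheory
open scoped LaurentPolynomial ComplexConjugate

noncomputable section

namespace CMVBispectral

/-- The value `f(z)` of a Laurent polynomial `f ∈ ℂ[z, z⁻¹]` at a point `z ∈ ℂ ∖ {0}`. -/
def ev (z : ℂˣ) : ℂ[T;T⁻¹] →+* ℂ :=
  LaurentPolynomial.eval₂ (RingHom.id ℂ) z

/-- The derivative `d/dz` on `ℂ[z, z⁻¹]`: `∑ₙ cₙ zⁿ ↦ ∑ₙ n cₙ zⁿ⁻¹`. -/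
def ddz (f : ℂ[T;T⁻¹]) : ℂ[T;T⁻¹] :=
  f.coeff.sum fun n c => LaurentPolynomial.C ((n : ℂ) * c) * LaurentPolynomial.T (n - 1)

/-- `D` is a linear differential operator on `ℂ[z, z⁻¹]` of order exactly `r`: it is given by
`D = ∑_{k=0}^r a_k(z) dᵏ/dzᵏ` with coefficient functions `a_k` on `ℂ ∖ {0}`, where `a_r` is not
identically zero. No regularity of the `a_k` is assumed; what is required is that `D` maps Laurent
polynomials to Laurent polynomials. -/
def IsDiffOp (r : ℕ) (D : ℂ[T;T⁻¹] →ₗ[ℂ] ℂ[T;T⁻¹]) : Prop :=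
  ∃ a : ℕ → ℂˣ → ℂ, a r ≠ 0 ∧
    ∀ (f : ℂ[T;T⁻¹]) (z : ℂˣ),
      ev z (D f) = ∑ k ∈ Finset.range (r + 1), a k z * ev z (ddz^[k] f)

/-- The exponents of the sequence `1, z⁻¹, z, z⁻², z², …`: `0, -1, 1, -2, 2, …`. -/
def cmvExp (n : ℕ) : ℤ :=
  if Even n then (n : ℤ) / 2 else -(((n : ℤ) + 1) / 2)

/-- The Borel σ-algebra on the unit circle. -/
instance circleMeasurableSpace : MeasurableSpace Circle := borel Circle

instance circleBorelSpace : BorelSpace Circle := ⟨rfl⟩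

/-- `x` is a sequence of orthonormal Laurent polynomials obtained by orthonormalization of
`1, z⁻¹, z, z⁻², z², …` in `L²(μ)`: it is orthonormal, and `x n` lies in the span of the first
`n + 1` of these powers. (This determines each `x n` up to a factor of modulus one.) -/
structure IsOLP (μ : Measure Circle) (x : ℕ → ℂ[T;T⁻¹]) : Prop where
  mem_span : ∀ n, x n ∈ Submodule.span ℂ
    ((fun k => (LaurentPolynomial.T (cmvExp k) : ℂ[T;T⁻¹])) '' Set.Iic n)
  orthonormal : ∀ m n, ∫ z : Circle, ev z.toUnits (x m) * conj (ev z.toUnits (x n)) ∂μ =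
    if m = n then 1 else 0

/-- The normalized Lebesgue measure `dθ / 2π` on the unit circle. -/
def lebesgueCircle : Measure Circle :=
  Measure.map Circle.exp
    (ENNReal.ofReal (2 * Real.pi)⁻¹ • (volume : Measure ℝ).restrict (Set.Ioc 0 (2 * Real.pi)))

end CMVBispectral

end

noncomputable section

namespace CMVBispectral

open Filter Topology

/-! ### Values of complex polynomials at integers -/

/-! Write `D zʲ = ∑ₘ Pₘ(j) zʲ⁺ᵐ` with polynomials `Pₘ`. The first `n` exponents of the ordering fill
an integer interval, extended alternately on the left and on the right. A tridiagonal `D` enlarges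
these spans by at most one step, so large powers of `z` cannot be pushed outward: `Pₘ` has
infinitely many zeros for `m ≠ 0`, and `D = p(z d/dz)` with `p` nonconstant
(`exists_diagonal_symbol`). Comparing leading coefficients, the monic `χₙ` then satisfy a two-term
relation: `(p(i) - p(eₙ₊₁)) [zⁱ]χₙ₊₁ = c [zⁱ]χₙ`, where `eₙ` is the `n`-th exponent.

On the other side, `χ₂ₖ = z⁻ᵏ Φ₂ₖ` and `χ₂ₖ₊₁ = z⁻ᵏ⁻¹ Φ*₂ₖ₊₁`, with the monic orthogonal polynomials
`Φₙ` obeying the Szegő recurrence (`isSzegoArray`). Let `gₙ = Φₙ(0)`, and let `sₙ` be the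
coefficient of `zⁿ⁻¹` in `Φₙ`. Combining the recurrence with the two-term relations determines
`|gₙ|²` as a quotient of differences of values of `p`, unless some `sₙ` vanishes. Asymptotics in `k`
contradict `|gₙ| < 1` when `p` has even degree or degree one; in odd degree at least three they
contradict `|sₙ| ≤ n`. So `s₂ₖ = 0` for large `k` (`eventually_subdiag_eq_zero`).

The relations then force `gₙ = 0` for large `n`, up to exceptional reflection symmetries of `p`, at
most one of which can occur (`eventually_coeff_zero_eq_zero`). Hence `Φₙ = zⁿ⁻ᴷ Φ_K` for `n ≥ K`;
one more use of the relations gives `Φ_K = zᴷ`, and the recurrence run backwards gives `Φₙ = zⁿ` for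
all `n` (`IsBispectralArray.eq_ite`). Powers of `z` have norm one for every probability measure on
the circle, so the `xₙ` are unimodular multiples of powers, orthonormal for Lebesgue measure.
Conversely, such `xₙ` are eigenvectors of `z d/dz`. -/

lemma eventually_eval_natCast_ne_zero {q : Polynomial ℂ} (hq : q ≠ 0) :
    ∀ᶠ k : ℕ in atTop, q.eval (k : ℂ) ≠ 0 := by
  have hfin : {k : ℕ | q.eval (k : ℂ) = 0}.Finite := by
    have h := (q.roots.toFinset.finite_toSet).preimage (f := fun k : ℕ => (k : ℂ))
      (Nat.cast_injective.injOn)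
    refine h.subset fun k hk => ?_
    simpa [hq] using hk
  have := hfin.eventually_cofinite_notMem
  rw [Nat.cofinite_eq_atTop] at this
  exact this

lemma natDegree_eq_zero_of_periodic {p : Polynomial ℂ} {h : ℂ} (hh : h ≠ 0)
    (hp : ∀ t, p.eval (t + h) = p.eval t) : p.natDegree = 0 := by
  have hval : ∀ k : ℕ, p.eval (k * h) = p.eval 0 := by
    intro k
    induction k with
    | zero => simp
    | succ k ih => rw [← ih, ← hp (k * h)]; congr 1; push_cast; ring
  have : p - Polynomial.C (p.eval 0) = 0 := by
    refine Polynomial.eq_zero_of_infinite_isRoot _ ?_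
    refine (Set.infinite_range_of_injective
      (f := fun k : ℕ => (k : ℂ) * h) ?_).mono ?_
    · intro a b hab
      exact Nat.cast_injective (mul_right_cancel₀ hh hab)
    · rintro _ ⟨k, rfl⟩
      simp [Polynomial.IsRoot, hval k]
  rw [sub_eq_zero.mp this, Polynomial.natDegree_C]

lemma eventually_eval_add_ne {p : Polynomial ℂ} (hp : 0 < p.natDegree) {i : ℂ} (hi : i ≠ 0) :
    ∀ᶠ k : ℕ in atTop, p.eval ((k : ℂ) + i) ≠ p.eval (k : ℂ) := by
  have hq : p.comp (Polynomial.X + Polynomial.C i) - p ≠ 0 := by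
    intro h
    refine hp.ne' (natDegree_eq_zero_of_periodic hi fun t => ?_)
    have := congrArg (Polynomial.eval t) h
    simpa [sub_eq_zero] using this
  filter_upwards [eventually_eval_natCast_ne_zero hq] with k hk
  simpa [sub_eq_zero] using hk

lemma symmetric_or_eventually_ne (p : Polynomial ℂ) (c : ℂ) :
    (∀ t, p.eval t = p.eval (c - t)) ∨
      ∀ᶠ k : ℕ in atTop, p.eval (k : ℂ) ≠ p.eval (c - k) := by
  by_cases hq : p - p.comp (Polynomial.C c - Polynomial.X) = 0
  · left
    intro t
    have := congrArg (Polynomial.eval t) hq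
    simpa [sub_eq_zero] using this
  · right
    filter_upwards [eventually_eval_natCast_ne_zero hq] with k hk
    simpa [sub_eq_zero] using hk

/-- Two reflections compose to the translation by `c' - c`, and a nonconstant polynomial has no
period. So at most one symmetry `t ↦ c - t` is possible. -/
lemma eventually_ne_of_symmetric {p : Polynomial ℂ} (hp : 0 < p.natDegree) {c c' : ℂ}
    (hc : ∀ t, p.eval t = p.eval (c - t)) (hcc : c ≠ c') :
    ∀ᶠ k : ℕ in atTop, p.eval (k : ℂ) ≠ p.eval (c' - k) := by
  refine (symmetric_or_eventually_ne p c').resolve_left fun hc' => hp.ne' ?_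
  refine natDegree_eq_zero_of_periodic (sub_ne_zero.mpr hcc.symm) fun t => ?_
  rw [hc t, hc' (t + (c' - c))]
  congr 1; ring

lemma tendsto_affine_div (ε c : ℂ) :
    Tendsto (fun k : ℕ => (ε * k + c) / k) atTop (𝓝 ε) := by
  have h1 : Tendsto (fun k : ℕ => ε + c * (k : ℂ)⁻¹) atTop (𝓝 (ε + c * 0)) :=
    tendsto_const_nhds.add (tendsto_const_nhds.mul
      (tendsto_inv_atTop_nhds_zero_nat (𝕜 := ℂ)))
  rw [mul_zero, add_zero] at h1
  refine h1.congr' ?_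
  filter_upwards [eventually_ne_atTop 0] with k hk
  have : (k : ℂ) ≠ 0 := Nat.cast_ne_zero.mpr hk
  field_simp

lemma tendsto_affine_pow_div (ε c : ℂ) (m : ℕ) :
    Tendsto (fun k : ℕ => (ε * k + c) ^ m / (k : ℂ) ^ m) atTop (𝓝 (ε ^ m)) := by
  simpa [div_pow] using (tendsto_affine_div ε c).pow m

lemma tendsto_affine_pow_div_zero (ε c : ℂ) {i m : ℕ} (him : i < m) :
    Tendsto (fun k : ℕ => (ε * k + c) ^ i / (k : ℂ) ^ m) atTop (𝓝 0) := by
  have h := (tendsto_affine_pow_div ε c i).mul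
    ((tendsto_inv_atTop_nhds_zero_nat (𝕜 := ℂ)).pow (m - i))
  rw [zero_pow (by omega), mul_zero] at h
  refine h.congr fun k => ?_
  rw [inv_pow, div_mul_eq_mul_div, ← div_eq_mul_inv, div_div, ← pow_add]
  congr 2; omega

lemma tendsto_affine_pow_sub_div (ε c : ℂ) (m : ℕ) :
    Tendsto (fun k : ℕ => ((ε * k + c) ^ (m + 1) - (ε * k) ^ (m + 1)) / (k : ℂ) ^ m) atTop
      (𝓝 ((m + 1) * c * ε ^ m)) := by
  induction m with
  | zero => simp
  | succ m ih =>
    have h := ((tendsto_affine_div ε c).mul ih).add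
      (tendsto_const_nhds (x := c * ε ^ (m + 1)))
    have hlim : ε * ((m + 1) * c * ε ^ m) + c * ε ^ (m + 1)
        = ((m + 1 : ℕ) + 1) * c * ε ^ (m + 1) := by push_cast; ring
    rw [hlim] at h
    refine h.congr' ?_
    filter_upwards [eventually_ne_atTop 0] with k hk
    have : (k : ℂ) ≠ 0 := Nat.cast_ne_zero.mpr hk
    field_simp
    ring

/-- The two leading terms of `p (ε k + c)` as `k → ∞`. -/
lemma tendsto_eval_affine_sub_div {p : Polynomial ℂ} {m : ℕ} (hp : p.natDegree ≤ m + 1)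
    (ε c : ℂ) :
    Tendsto (fun k : ℕ => (p.eval (ε * k + c) - p.coeff (m + 1) * (ε * k) ^ (m + 1))
      / (k : ℂ) ^ m) atTop
      (𝓝 (ε ^ m * (p.coeff m + (m + 1) * c * p.coeff (m + 1)))) := by
  have h1 : Tendsto (fun k : ℕ => ∑ i ∈ Finset.range m,
      p.coeff i * ((ε * k + c) ^ i / (k : ℂ) ^ m)) atTop
      (𝓝 (∑ i ∈ Finset.range m, p.coeff i * 0)) :=
    tendsto_finsetSum _ fun i hi => tendsto_const_nhds.mul
      (tendsto_affine_pow_div_zero ε c (Finset.mem_range.mp hi))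
  have h2 := (h1.add ((tendsto_affine_pow_div ε c m).const_mul (p.coeff m))).add
    ((tendsto_affine_pow_sub_div ε c m).const_mul (p.coeff (m + 1)))
  have hlim : ∑ i ∈ Finset.range m, p.coeff i * 0 + p.coeff m * ε ^ m
      + p.coeff (m + 1) * ((m + 1) * c * ε ^ m)
      = ε ^ m * (p.coeff m + (m + 1) * c * p.coeff (m + 1)) := by simp; ring
  rw [hlim] at h2
  refine h2.congr fun k => ?_
  rw [Polynomial.eval_eq_sum_range' (n := m + 2) (by omega), Finset.sum_range_succ,
    Finset.sum_range_succ, add_sub_assoc, add_div, add_div, Finset.sum_div]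
  congr 1
  · congr 1
    · exact Finset.sum_congr rfl fun i _ => by ring
    · ring
  · ring

lemma tendsto_eval_affine_div {p : Polynomial ℂ} {m : ℕ} (hp : p.natDegree ≤ m + 1)
    (ε c : ℂ) :
    Tendsto (fun k : ℕ => p.eval (ε * k + c) / (k : ℂ) ^ (m + 1)) atTop
      (𝓝 (p.coeff (m + 1) * ε ^ (m + 1))) := by
  have h := ((tendsto_eval_affine_sub_div hp ε c).mul
    (tendsto_inv_atTop_nhds_zero_nat (𝕜 := ℂ))).add_const (p.coeff (m + 1) * ε ^ (m + 1))
  rw [mul_zero, zero_add] at h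
  refine h.congr' ?_
  filter_upwards [eventually_ne_atTop 0] with k hk
  have : (k : ℂ) ≠ 0 := Nat.cast_ne_zero.mpr hk
  field_simp
  ring

/-! ### Coefficient arrays of monic orthogonal polynomials on the unit circle -/

/-- `A n j` is the coefficient of `z ^ j` in the `n`-th member of a sequence of monic polynomials
satisfying the Szegő recurrence `Φₙ₊₁ = z Φₙ + Φₙ₊₁(0) Φₙ*` with `|Φₙ₊₁(0)| < 1`. -/
structure IsSzegoArray (A : ℕ → ℤ → ℂ) : Prop where
  diag : ∀ n : ℕ, A n n = 1
  of_neg : ∀ (n : ℕ) (j : ℤ), j < 0 → A n j = 0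
  step : ∀ (n : ℕ) (j : ℤ), A (n + 1) j = A n (j - 1) + A (n + 1) 0 * conj (A n (n - j))
  norm_lt : ∀ n : ℕ, ‖A (n + 1) 0‖ < 1

/-- The relation `p(z d/dz) xₙ ∈ span {xₙ₋₁, xₙ}` for all `n > 2 N`, in terms of coefficients. -/
structure IsBispectralArray (p : Polynomial ℂ) (N : ℕ) (A : ℕ → ℤ → ℂ) : Prop where
  odd : ∀ k : ℕ, N ≤ k → ∀ j : ℤ,
    conj (p.eval ((k : ℂ) - j) - p.eval (-k - 1 : ℂ)) * A (2 * k + 1) j =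
      A (2 * k + 1) 0 * conj (p.eval (k : ℂ) - p.eval (-k - 1 : ℂ)) * conj (A (2 * k) (2 * k - j))
  even : ∀ k : ℕ, N ≤ k → ∀ j : ℤ,
    (p.eval ((j : ℂ) - k - 1) - p.eval (k + 1 : ℂ)) * A (2 * k + 2) j =
      A (2 * k + 2) 0 * (p.eval (-k - 1 : ℂ) - p.eval (k + 1 : ℂ)) *
        conj (A (2 * k + 1) (2 * k + 1 - j))

namespace IsSzegoArray

variable {A : ℕ → ℤ → ℂ}

lemma subdiag_succ (hA : IsSzegoArray A) (n : ℕ) :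
    A (n + 1) n = A n (n - 1) + A (n + 1) 0 * conj (A n 0) := by
  have := hA.step n n
  rwa [sub_self] at this

lemma coeff_one (hA : IsSzegoArray A) (n : ℕ) :
    A (n + 1) 1 = A n 0 + A (n + 1) 0 * conj (A n (n - 1)) := by
  have := hA.step n 1
  rwa [sub_self] at this

lemma norm_coeff_zero_le (hA : IsSzegoArray A) (n : ℕ) : ‖A n 0‖ ≤ 1 := by
  cases n with
  | zero => have := hA.diag 0; simp_all
  | succ n => exact (hA.norm_lt n).le

/-- Each Szegő step changes the subdiagonal entry by a product of two constant coefficients, of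
modulus at most one. This linear growth excludes symbols of odd degree at least three. -/
lemma norm_subdiag_le (hA : IsSzegoArray A) (n : ℕ) : ‖A n (n - 1)‖ ≤ n := by
  induction n with
  | zero => rw [hA.of_neg _ _ (by simp)]; simp
  | succ n ih =>
    have h := hA.subdiag_succ n
    push_cast
    rw [add_sub_cancel_right, h]
    refine (norm_add_le _ _).trans (add_le_add ih ?_)
    rw [norm_mul, RCLike.norm_conj]
    exact mul_le_one₀ (hA.norm_coeff_zero_le _) (norm_nonneg _) (hA.norm_coeff_zero_le _)

end IsSzegoArray

/-! ### Consequences of the two-term relation for the extreme coefficients -/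

section Relations

variable {A : ℕ → ℤ → ℂ} {p : Polynomial ℂ} {N : ℕ}

lemma IsBispectralArray.smul (hB : IsBispectralArray p N A) (c : ℂ) :
    IsBispectralArray (Polynomial.C c * p) N A where
  odd k hk j := by
    have := hB.odd k hk j
    simp only [Polynomial.eval_mul, Polynomial.eval_C, ← mul_sub, map_mul] at this ⊢
    linear_combination conj c * this
  even k hk j := by
    have := hB.even k hk j
    simp only [Polynomial.eval_mul, Polynomial.eval_C, ← mul_sub] at this ⊢
    linear_combination c * this

/-- The two-term relation read just below the top coefficient; the product of constant coefficients
on its right side is a difference of consecutive subdiagonal entries by the Szegő recurrence. -/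
lemma subdiag_even_relation (hA : IsSzegoArray A) (hB : IsBispectralArray p N A)
    {k : ℕ} (hk : N ≤ k) :
    A (2 * k + 2) (2 * k + 1) * (p.eval (k : ℂ) - p.eval (-k - 1 : ℂ)) =
      A (2 * k + 1) (2 * k) * (p.eval (k + 1 : ℂ) - p.eval (-k - 1 : ℂ)) := by
  have h := hB.even k hk (2 * k + 1)
  have hs := hA.subdiag_succ (2 * k + 1)
  push_cast at h hs
  rw [add_sub_cancel_right] at hs
  rw [sub_self] at h
  have e : (2 * k + 1 - k - 1 : ℂ) = k := by ring
  rw [e] at h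
  linear_combination h - (p.eval (-k - 1 : ℂ) - p.eval (k + 1 : ℂ)) * hs

lemma subdiag_odd_relation (hA : IsSzegoArray A) (hB : IsBispectralArray p N A)
    {k : ℕ} (hk : N ≤ k) :
    A (2 * k + 1) (2 * k) * conj (p.eval (k : ℂ) - p.eval (-k : ℂ)) =
      A (2 * k) (2 * k - 1) * conj (p.eval (k : ℂ) - p.eval (-k - 1 : ℂ)) := by
  have h := hB.odd k hk (2 * k)
  have hs := hA.subdiag_succ (2 * k)
  push_cast at h hs
  rw [sub_self] at h
  have e : (k - 2 * k : ℂ) = -k := by ring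
  rw [e] at h
  simp only [map_sub] at h ⊢
  linear_combination
    (conj (p.eval (k : ℂ)) - conj (p.eval (-k - 1 : ℂ))) * hs - h

/-- The two-term relation read at the coefficient of `z`, which the Szegő recurrence expresses
through constant and subdiagonal coefficients. -/
lemma coeff_zero_even_relation (hA : IsSzegoArray A) (hB : IsBispectralArray p N A)
    {k : ℕ} (hk : N ≤ k) :
    (p.eval (k + 1 : ℂ) - p.eval (-k : ℂ)) * A (2 * k + 1) 0 =
      A (2 * k + 2) 0 * conj (A (2 * k + 1) (2 * k)) *
        (p.eval (-k : ℂ) - p.eval (-k - 1 : ℂ)) := by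
  have h := hB.even k hk 1
  have hs := hA.coeff_one (2 * k + 1)
  push_cast at h hs
  rw [add_sub_cancel_right] at hs h
  have e : (1 - k - 1 : ℂ) = -k := by ring
  rw [e, hs] at h
  linear_combination -h

lemma coeff_zero_odd_relation (hA : IsSzegoArray A) (hB : IsBispectralArray p N A)
    {k : ℕ} (hk : N ≤ k) :
    conj (p.eval (k - 1 : ℂ) - p.eval (-k - 1 : ℂ)) * A (2 * k) 0 =
      A (2 * k + 1) 0 * conj (A (2 * k) (2 * k - 1)) *
        conj (p.eval (k : ℂ) - p.eval (k - 1 : ℂ)) := by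
  have h := hB.odd k hk 1
  have hs := hA.coeff_one (2 * k)
  push_cast at h hs
  rw [hs] at h
  simp only [map_sub] at h ⊢
  linear_combination h

/-- Eliminate `s₂ₖ₊₁` and `g₂ₖ₊₁` from the two relations above and `s₂ₖ₊₂ = s₂ₖ₊₁ + g₂ₖ₊₂ conj
g₂ₖ₊₁`. What remains is a multiple of `conj s₂ₖ₊₂`, which cancels, leaving only `|g₂ₖ₊₂|²` and
values of `p`. -/
lemma normSq_coeff_zero_even (hA : IsSzegoArray A) (hB : IsBispectralArray p N A)
    {k : ℕ} (hk : N ≤ k) (hne : A (2 * k + 2) (2 * k + 1) ≠ 0) :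
    (p.eval (k + 1 : ℂ) - p.eval (-k : ℂ)) * conj (p.eval (k + 1 : ℂ) - p.eval (k : ℂ)) =
      (Complex.normSq (A (2 * k + 2) 0) : ℂ) * (conj (p.eval (k : ℂ) - p.eval (-k - 1 : ℂ)) *
        (p.eval (-k : ℂ) - p.eval (-k - 1 : ℂ))) := by
  have h1 := congrArg conj (subdiag_even_relation hA hB hk)
  have h2 := coeff_zero_even_relation hA hB hk
  have hs := congrArg conj (hA.subdiag_succ (2 * k + 1))
  push_cast at hs
  rw [add_sub_cancel_right] at hs
  refine mul_left_cancel₀ ((map_ne_zero (starRingEnd ℂ)).mpr hne) ?_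
  rw [Complex.normSq_eq_conj_mul_self]
  simp only [map_sub, map_mul, map_add, Complex.conj_conj] at *
  generalize p.eval (k + 1 : ℂ) = a at *
  generalize p.eval (k : ℂ) = b at *
  generalize p.eval (-k : ℂ) = c at *
  generalize p.eval (-k - 1 : ℂ) = d at *
  linear_combination (conj (A (2 * k + 2) 0)) * (conj a - conj d) * h2
    + (a - c) * (conj a - conj d) * hs
    - ((a - c) + conj (A (2 * k + 2) 0) * A (2 * k + 2) 0 * (c - d)) * h1

lemma normSq_coeff_zero_odd (hA : IsSzegoArray A) (hB : IsBispectralArray p N A)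
    {k : ℕ} (hk : N ≤ k) (hne : A (2 * k) (2 * k - 1) ≠ 0) :
    (p.eval (k - 1 : ℂ) - p.eval (-k - 1 : ℂ)) * conj (p.eval (-k : ℂ) - p.eval (-k - 1 : ℂ)) =
      (Complex.normSq (A (2 * k + 1) 0) : ℂ) * ((p.eval (k : ℂ) - p.eval (k - 1 : ℂ)) *
        conj (p.eval (k : ℂ) - p.eval (-k : ℂ))) := by
  have h1 := subdiag_odd_relation hA hB hk
  have h2 := congrArg conj (coeff_zero_odd_relation hA hB hk)
  have hs := hA.subdiag_succ (2 * k)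
  push_cast at hs
  refine mul_left_cancel₀ hne ?_
  rw [Complex.normSq_eq_conj_mul_self]
  simp only [map_sub, map_mul, Complex.conj_conj] at *
  generalize p.eval (k - 1 : ℂ) = a at *
  generalize p.eval (k : ℂ) = b at *
  generalize p.eval (-k : ℂ) = c at *
  generalize p.eval (-k - 1 : ℂ) = d at *
  linear_combination (A (2 * k + 1) 0) * (conj b - conj c) * h2
    + (a - d) * (conj b - conj c) * hs
    - (a - d) * h1

end Relations

/-! ### Asymptotics in `k`: the subdiagonal entries of even rows vanish -/

section Core

variable {A : ℕ → ℤ → ℂ} {p : Polynomial ℂ} {N : ℕ}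

lemma re_mul_lt_of_re_lt {u : ℂ} {R G : ℝ} (hR : 0 < R) (hG0 : 0 ≤ G) (hG1 : G ≤ 1)
    (hu : u.re < R) : ((G : ℂ) * u).re < R := by
  rw [Complex.re_ofReal_mul]
  rcases le_or_gt u.re 0 with h | h
  · exact (mul_nonpos_of_nonneg_of_nonpos hG0 h).trans_lt hR
  · exact (mul_le_of_le_one_left h.le hG1).trans_lt hu

lemma normSq_le_one {z : ℂ} (hz : ‖z‖ ≤ 1) : Complex.normSq z ≤ 1 := by
  rw [Complex.normSq_eq_norm_sq]
  exact pow_le_one₀ (norm_nonneg z) hz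

lemma conj_natCast_pow (k m : ℕ) : conj ((k : ℂ) ^ m) = (k : ℂ) ^ m := by simp

section EvenDegree

variable {m : ℕ}

lemma tendsto_sub_plus_plus (hp : p.natDegree ≤ m + 1) (hlead : p.coeff (m + 1) = 1)
    (c c' : ℂ) :
    Tendsto (fun k : ℕ => (p.eval (k + c) - p.eval (k + c')) / (k : ℂ) ^ m) atTop
      (𝓝 ((m + 1) * (c - c'))) := by
  have h := (tendsto_eval_affine_sub_div hp 1 c).sub (tendsto_eval_affine_sub_div hp 1 c')
  rw [hlead] at h
  have e : 1 ^ m * (p.coeff m + (m + 1) * c * 1) - 1 ^ m * (p.coeff m + (m + 1) * c' * 1)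
    = (m + 1) * (c - c') := by simp; ring
  rw [e] at h
  refine h.congr fun k => ?_
  rw [one_mul]; ring

/-- In even degree `m + 1` the leading terms at `k` and `-k` cancel, so the difference has order
`kᵐ` and its limit sees the second coefficient of `p`. -/
lemma tendsto_sub_plus_minus (hp : p.natDegree ≤ m + 1) (hlead : p.coeff (m + 1) = 1)
    (hm : Odd m) (c c' : ℂ) :
    Tendsto (fun k : ℕ => (p.eval (k + c) - p.eval (-k + c')) / (k : ℂ) ^ m) atTop
      (𝓝 (2 * p.coeff m + (m + 1) * (c + c'))) := by
  have h := (tendsto_eval_affine_sub_div hp 1 c).sub (tendsto_eval_affine_sub_div hp (-1) c')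
  rw [hlead, hm.neg_one_pow] at h
  have e : 1 ^ m * (p.coeff m + (m + 1) * c * 1) - (-1) * (p.coeff m + (m + 1) * c' * 1)
    = 2 * p.coeff m + (m + 1) * (c + c') := by simp; ring
  rw [e] at h
  refine h.congr fun k => ?_
  rw [one_mul, neg_one_mul, hm.add_one.neg_pow]; ring

lemma tendsto_sub_minus_minus (hp : p.natDegree ≤ m + 1) (hlead : p.coeff (m + 1) = 1)
    (hm : Odd m) (c c' : ℂ) :
    Tendsto (fun k : ℕ => (p.eval (-k + c) - p.eval (-k + c')) / (k : ℂ) ^ m) atTop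
      (𝓝 (-((m + 1) * (c - c')))) := by
  have h := (tendsto_eval_affine_sub_div hp (-1) c).sub (tendsto_eval_affine_sub_div hp (-1) c')
  rw [hlead, hm.neg_one_pow] at h
  have e : (-1) * (p.coeff m + (m + 1) * c * 1) - (-1) * (p.coeff m + (m + 1) * c' * 1)
    = -((m + 1) * (c - c')) := by ring
  rw [e] at h
  refine h.congr fun k => ?_
  rw [neg_one_mul]; ring

/-- Put `b = p.coeff m` and divide `normSq_coeff_zero_even` by `k²ᵐ`. The left side has limiting
real part `(m+1)(m+1+2 Re b)`, while the factor of `|g₂ₖ₊₂|² ≤ 1` on the right has `(m+1)(m+1-2 Re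
b)`: impossible for `Re b > 0`. -/
lemma eventually_subdiag_eq_zero_of_pos (hp : p.natDegree ≤ m + 1) (hlead : p.coeff (m + 1) = 1)
    (hA : IsSzegoArray A) (hB : IsBispectralArray p N A)
    (hm : Odd m) (hre : 0 < (p.coeff m).re) :
    ∀ᶠ k : ℕ in atTop, A (2 * k + 2) (2 * k + 1) = 0 := by
  have hv := tendsto_sub_plus_minus hp hlead hm 1 0
  have ha := tendsto_sub_plus_plus hp hlead 1 0
  have hd := tendsto_sub_plus_minus hp hlead hm 0 (-1)
  have he := tendsto_sub_minus_minus hp hlead hm 0 (-1)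
  have hL := (Complex.continuous_re.tendsto _).comp
    (hv.mul ((Complex.continuous_conj.tendsto _).comp ha))
  have hR := (Complex.continuous_re.tendsto _).comp
    (((Complex.continuous_conj.tendsto _).comp hd).mul he)
  have hm0 : (0 : ℝ) < m + 1 := by positivity
  -- The value `(m + 1)²` strictly separates the two limiting real parts.
  have hL' := hL.eventually_const_lt (u := ((m : ℝ) + 1) ^ 2) (by
    simp; nlinarith)
  have hR' := hR.eventually_lt_const (u := ((m : ℝ) + 1) ^ 2) (by
    simp; nlinarith)
  filter_upwards [hL', hR', eventually_ge_atTop N, eventually_ne_atTop 0] with k h1 h2 hk hk0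
  by_contra hne
  have hI := normSq_coeff_zero_even hA hB hk hne
  have h3 := re_mul_lt_of_re_lt (by positivity) (Complex.normSq_nonneg _)
    (normSq_le_one (hA.norm_coeff_zero_le (2 * k + 2))) h2
  refine (h1.trans ?_).false
  refine lt_of_eq_of_lt (congrArg Complex.re ?_) h3
  simp only [Function.comp_apply, map_div₀, conj_natCast_pow, add_zero, ← sub_eq_add_neg]
  rw [div_mul_div_comm, div_mul_div_comm, hI]
  ring

lemma eventually_subdiag_eq_zero_of_nonpos (hp : p.natDegree ≤ m + 1) (hlead : p.coeff (m + 1) = 1)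
    (hA : IsSzegoArray A) (hB : IsBispectralArray p N A)
    (hm : Odd m) (hre : (p.coeff m).re ≤ 0) :
    ∀ᶠ k : ℕ in atTop, A (2 * k) (2 * k - 1) = 0 := by
  have hc := tendsto_sub_plus_minus hp hlead hm (-1) (-1)
  have he := tendsto_sub_minus_minus hp hlead hm 0 (-1)
  have ha := tendsto_sub_plus_plus hp hlead 0 (-1)
  have ho := tendsto_sub_plus_minus hp hlead hm 0 0
  have hL := (Complex.continuous_re.tendsto _).comp
    (hc.mul ((Complex.continuous_conj.tendsto _).comp he))
  have hR := (Complex.continuous_re.tendsto _).comp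
    (ha.mul ((Complex.continuous_conj.tendsto _).comp ho))
  have hm0 : (0 : ℝ) < m + 1 := by positivity
  -- Now the limiting real parts are `2(m+1)(m+1 - Re b) ≥ 2(m+1)²` on the left and `2(m+1) Re b ≤
  -- 0` for the factor on the right, with `b = p.coeff m`.
  have hL' := hL.eventually_const_lt (u := ((m : ℝ) + 1) ^ 2) (by
    simp; nlinarith)
  have hR' := hR.eventually_lt_const (u := ((m : ℝ) + 1) ^ 2) (by
    simp; nlinarith)
  filter_upwards [hL', hR', eventually_ge_atTop N, eventually_ne_atTop 0] with k h1 h2 hk hk0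
  by_contra hne
  have hI := normSq_coeff_zero_odd hA hB hk hne
  have h3 := re_mul_lt_of_re_lt (by positivity) (Complex.normSq_nonneg _)
    (normSq_le_one (hA.norm_coeff_zero_le (2 * k + 1))) h2
  refine (h1.trans ?_).false
  refine lt_of_eq_of_lt (congrArg Complex.re ?_) h3
  simp only [Function.comp_apply, map_div₀, conj_natCast_pow, add_zero, ← sub_eq_add_neg]
  rw [div_mul_div_comm, div_mul_div_comm, hI]
  ring

end EvenDegree

lemma eventually_shift_iff :
    (∀ᶠ k : ℕ in atTop, A (2 * k + 2) (2 * k + 1) = 0) ↔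
      ∀ᶠ k : ℕ in atTop, A (2 * k) (2 * k - 1) = 0 := by
  have h := eventually_map (f := atTop) (m := fun k : ℕ => k + 1)
    (P := fun k : ℕ => A (2 * k) (2 * k - 1) = 0)
  rw [map_add_atTop_eq_nat] at h
  rw [h]
  refine eventually_congr (Eventually.of_forall fun k => ?_)
  have e : (2 * ((k + 1 : ℕ) : ℤ) - 1) = 2 * k + 1 := by push_cast; ring
  rw [e, mul_add, mul_one]

/-- For `p = t + const` both products in `normSq_coeff_zero_even` equal `2k + 1`, which would force
`|g₂ₖ₊₂| = 1`. Here the strict bound `norm_lt` is needed. -/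
lemma subdiag_eq_zero_of_natDegree_le_one (hA : IsSzegoArray A) (hB : IsBispectralArray p N A)
    (hp : p.natDegree ≤ 1) (hlead : p.coeff 1 = 1)
    {k : ℕ} (hk : N ≤ k) : A (2 * k + 2) (2 * k + 1) = 0 := by
  by_contra hne
  have hI := normSq_coeff_zero_even hA hB hk hne
  have hev : ∀ t, p.eval t = t + p.coeff 0 := by
    intro t
    rw [Polynomial.eval_eq_sum_range' (n := 2) (by omega)]
    simp [Finset.sum_range_succ, hlead, add_comm]
  simp only [hev] at hI
  have h1 : ((1 - Complex.normSq (A (2 * k + 2) 0) : ℝ) : ℂ) * ((2 * k + 1 : ℕ) : ℂ) = 0 := by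
    simp only [map_sub, map_add, map_neg, map_one, Complex.conj_natCast] at hI
    push_cast
    linear_combination hI
  rcases mul_eq_zero.mp h1 with h | h
  · have h2 := Complex.ofReal_eq_zero.mp h
    have h3 := hA.norm_lt (2 * k + 1)
    rw [Complex.normSq_eq_norm_sq] at h2
    have := norm_nonneg (A (2 * k + 1 + 1) 0)
    nlinarith
  · exact Nat.cast_ne_zero.mpr (by omega) h

/-- Let `o k = p(k) - p(-k)`. The two subdiagonal relations combine to make `|s₂ₖ| / |o k|`
eventually constant. In odd degree `m + 1`, `|o k|` grows like `2kᵐ⁺¹`, whereas `|s₂ₖ| ≤ 2k`; for `m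
≥ 2` the constant must be zero. -/
lemma eventually_subdiag_eq_zero_of_even (hA : IsSzegoArray A) (hB : IsBispectralArray p N A)
    {m : ℕ} (hp : p.natDegree ≤ m + 1)
    (hlead : p.coeff (m + 1) = 1) (hm : Even m) (hm0 : m ≠ 0) :
    ∀ᶠ k : ℕ in atTop, A (2 * k) (2 * k - 1) = 0 := by
  set o : ℕ → ℂ := fun k => p.eval (k : ℂ) - p.eval (-k : ℂ) with ho_def
  set w : ℕ → ℂ := fun k => p.eval (k : ℂ) - p.eval (-k - 1 : ℂ) with hw_def
  set s : ℕ → ℂ := fun k => A (2 * k) (2 * k - 1) with hs_def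
  have hlim : ∀ c : ℂ, Tendsto (fun k : ℕ => (p.eval (k : ℂ) - p.eval (-k + c : ℂ))
      / (k : ℂ) ^ (m + 1)) atTop (𝓝 2) := by
    intro c
    have h := (tendsto_eval_affine_div hp 1 0).sub (tendsto_eval_affine_div hp (-1) c)
    rw [hlead, hm.add_one.neg_one_pow] at h
    have e : (1 : ℂ) * 1 ^ (m + 1) - 1 * -1 = 2 := by simp; norm_num
    rw [e] at h
    refine h.congr fun k => ?_
    rw [one_mul, neg_one_mul, add_zero, sub_div]
  have hlo : Tendsto (fun k => o k / (k : ℂ) ^ (m + 1)) atTop (𝓝 2) := by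
    simpa using hlim 0
  have hlw : Tendsto (fun k => w k / (k : ℂ) ^ (m + 1)) atTop (𝓝 2) := by
    simpa [← sub_eq_add_neg] using hlim (-1)
  have ho : ∀ᶠ k in atTop, o k ≠ 0 := by
    filter_upwards [hlo.eventually_ne two_ne_zero] with k hk h
    simp [h] at hk
  have hw : ∀ᶠ k in atTop, w k ≠ 0 := by
    filter_upwards [hlw.eventually_ne two_ne_zero] with k hk h
    simp [h] at hk
  have hstep : ∀ k, N ≤ k → w k ≠ 0 → ‖s (k + 1)‖ * ‖o k‖ = ‖s k‖ * ‖o (k + 1)‖ := by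
    intro k hk hwk
    have h1 := congrArg norm (subdiag_even_relation hA hB hk)
    have h2 := congrArg norm (subdiag_odd_relation hA hB hk)
    rw [norm_mul, norm_mul] at h1
    rw [norm_mul, norm_mul, RCLike.norm_conj, RCLike.norm_conj] at h2
    have es : s (k + 1) = A (2 * k + 2) (2 * k + 1) := by
      simp only [hs_def]
      have e : (2 * ((k + 1 : ℕ) : ℤ) - 1) = 2 * k + 1 := by push_cast; ring
      rw [e, mul_add, mul_one]
    have eo : o (k + 1) = p.eval (k + 1 : ℂ) - p.eval (-k - 1 : ℂ) := by
      simp only [ho_def]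
      push_cast
      rw [neg_add']
    rw [es, eo]
    refine mul_left_cancel₀ (norm_ne_zero_iff.mpr hwk) ?_
    simp only [hs_def, ho_def, hw_def] at *
    linear_combination ‖p.eval (k : ℂ) - p.eval (-k : ℂ)‖ * h1
      + ‖p.eval (k + 1 : ℂ) - p.eval (-k - 1 : ℂ)‖ * h2
  obtain ⟨K, hK⟩ := eventually_atTop.mp (ho.and (hw.and (eventually_ge_atTop N)))
  set c : ℝ := ‖s K‖ / ‖o K‖ with hc_def
  have hconst : ∀ k, K ≤ k → ‖s k‖ = c * ‖o k‖ := by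
    intro k hk
    induction k, hk using Nat.le_induction with
    | base => rw [hc_def, div_mul_cancel₀ _ (norm_ne_zero_iff.mpr (hK K le_rfl).1)]
    | succ k hk ih =>
      obtain ⟨h1, h2, h3⟩ := hK k hk
      refine mul_right_cancel₀ (norm_ne_zero_iff.mpr h1) ?_
      rw [hstep k h3 h2, ih]; ring
  have hz : Tendsto (fun k : ℕ => c * ‖o k / (k : ℂ) ^ (m + 1)‖) atTop (𝓝 0) := by
    have hb : Tendsto (fun k : ℕ => 2 * ((k : ℝ)⁻¹) ^ m) atTop (𝓝 (2 * 0 ^ m)) :=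
      ((tendsto_inv_atTop_nhds_zero_nat (𝕜 := ℝ)).pow m).const_mul 2
    rw [zero_pow hm0, mul_zero] at hb
    refine squeeze_zero' (Eventually.of_forall fun k => by positivity) ?_ hb
    filter_upwards [eventually_ge_atTop K, eventually_ne_atTop 0] with k hk hk0
    have hb := hA.norm_subdiag_le (2 * k)
    push_cast at hb
    have hkpos : (0 : ℝ) < k := by positivity
    rw [norm_div, ← mul_div_assoc, ← hconst k hk, norm_pow, Complex.norm_natCast,
      div_le_iff₀ (by positivity)]
    refine hb.trans (le_of_eq ?_)
    rw [pow_succ, inv_pow]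
    field_simp
  have hc0 : c = 0 := by
    have := tendsto_nhds_unique hz (hlo.norm.const_mul c)
    simpa using this.symm
  filter_upwards [eventually_ge_atTop K] with k hk
  simpa [hc0] using hconst k hk

/-- The subdiagonal entries in the even rows eventually vanish. -/
lemma eventually_subdiag_eq_zero (hA : IsSzegoArray A) (hB : IsBispectralArray p N A)
    (hp : 0 < p.natDegree) (hlead : p.Monic) :
    ∀ᶠ k : ℕ in atTop, A (2 * k) (2 * k - 1) = 0 := by
  obtain ⟨m, hm⟩ : ∃ m, p.natDegree = m + 1 := ⟨p.natDegree - 1, by omega⟩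
  have hl : p.coeff (m + 1) = 1 := by rw [← hm]; exact hlead
  rcases Nat.even_or_odd m with h | h
  · rcases eq_or_ne m 0 with rfl | h0
    · rw [← eventually_shift_iff]
      filter_upwards [eventually_ge_atTop N] with k hk
      exact subdiag_eq_zero_of_natDegree_le_one hA hB hm.le hl hk
    · exact eventually_subdiag_eq_zero_of_even hA hB hm.le hl h h0
  · rcases lt_or_ge 0 (p.coeff m).re with hr | hr
    · rw [← eventually_shift_iff]
      exact eventually_subdiag_eq_zero_of_pos hm.le hl hA hB h hr
    · exact eventually_subdiag_eq_zero_of_nonpos hm.le hl hA hB h hr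

end Core

/-! ### Vanishing of the constant coefficients and rigidity of the array -/

section Vanishing

variable {A : ℕ → ℤ → ℂ} {p : Polynomial ℂ} {N : ℕ}

/-- When the constant coefficient vanishes, so does the right side of the two-term relation, and
`p(k-1) ≠ p(k+1)` for large `k`. -/
lemma coeff_two_below_even_eq_zero (hB : IsBispectralArray p N A) (hp : 0 < p.natDegree)
    (hg : ∀ᶠ k : ℕ in atTop, A (2 * k + 2) 0 = 0) :
    ∀ᶠ k : ℕ in atTop, A (2 * k + 2) (2 * k) = 0 := by
  have hne := (tendsto_add_atTop_nat 1).eventually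
    (eventually_eval_add_ne hp (i := -2) (by norm_num))
  filter_upwards [hg, hne, eventually_ge_atTop N] with k h1 h2 hk
  have h := hB.even k hk (2 * k)
  rw [h1, zero_mul, zero_mul, mul_eq_zero] at h
  refine h.resolve_left fun h' => h2 ?_
  push_cast at h' ⊢
  rw [← sub_eq_zero, ← h']
  congr 2; ring

lemma coeff_two_below_odd_eq_zero (hB : IsBispectralArray p N A) (hp : 0 < p.natDegree)
    (hg : ∀ᶠ k : ℕ in atTop, A (2 * k + 1) 0 = 0) :
    ∀ᶠ k : ℕ in atTop, A (2 * k + 1) (2 * k - 1) = 0 := by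
  have hp' : 0 < (p.comp (-Polynomial.X)).natDegree := by
    rw [Polynomial.natDegree_comp]; simpa using hp
  have hne := (tendsto_add_atTop_nat 1).eventually
    (eventually_eval_add_ne hp' (i := -2) (by norm_num))
  filter_upwards [hg, hne, eventually_ge_atTop N] with k h1 h2 hk
  have h := hB.odd k hk (2 * k - 1)
  rw [h1, zero_mul, zero_mul, mul_eq_zero, map_eq_zero] at h
  refine h.resolve_left fun h' => h2 ?_
  simp only [Polynomial.eval_comp, Polynomial.eval_neg, Polynomial.eval_X]
  push_cast at h' ⊢
  rw [← sub_eq_zero, ← h']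
  congr 2 <;> ring

/-- In this symmetric case the relation at the coefficient of `z` carries no information, so the
coefficient of `z³` is used instead. Three Szegő steps carry it unchanged down to a constant
coefficient: `A (2k+4) 3 = A (2k+3) 2 = A (2k+2) 1 = A (2k+1) 0`. -/
lemma coeff_zero_odd_eq_zero_of_even (hA : IsSzegoArray A) (hB : IsBispectralArray p N A)
    (hp : 0 < p.natDegree) (hc : ∀ t, p.eval t = p.eval (1 - t))
    (hg : ∀ᶠ k : ℕ in atTop, A (2 * k + 2) 0 = 0) :
    ∀ᶠ k : ℕ in atTop, A (2 * k + 1) 0 = 0 := by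
  -- The factor at `z³` in row `2k + 4` is `p(1-k) - p(k+2)`, whose arguments add up to `3`;
  -- symmetry with sum `1` rules out symmetry with sum `3`.
  have hne := (tendsto_add_atTop_nat 2).eventually
    (eventually_ne_of_symmetric hp hc (c' := 3) (by norm_num))
  filter_upwards [hg, (tendsto_add_atTop_nat 1).eventually hg, hne, eventually_ge_atTop N,
    coeff_two_below_even_eq_zero hB hp hg] with k h0 h1 h2 hk h3
  have h := hB.even (k + 1) (by omega) 3
  rw [h1, zero_mul, zero_mul, mul_eq_zero] at h
  have hz : A (2 * (k + 1) + 2) 3 = 0 := by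
    refine h.resolve_left fun h' => h2 ?_
    push_cast at h' ⊢
    rw [eq_comm, ← sub_eq_zero, ← h']
    congr 2 <;> ring
  have e1 := hA.step (2 * (k + 1) + 1) 3
  have e2 := hA.step (2 * k + 2) 2
  have e3 := hA.coeff_one (2 * k + 1)
  push_cast at e2
  rw [hz, h1, zero_mul, add_zero] at e1
  rw [add_sub_cancel_right, h3, map_zero, mul_zero, add_zero] at e2
  rw [h0, zero_mul, add_zero] at e3
  rw [← e3]
  norm_num at e1 e2
  rw [← e2]
  exact e1.symm

lemma coeff_zero_even_eq_zero_of_odd (hA : IsSzegoArray A) (hB : IsBispectralArray p N A)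
    (hp : 0 < p.natDegree) (hc : ∀ t, p.eval t = p.eval (-2 - t))
    (hg : ∀ᶠ k : ℕ in atTop, A (2 * k + 1) 0 = 0) :
    ∀ᶠ k : ℕ in atTop, A (2 * k) 0 = 0 := by
  -- The factor at `z³` in row `2k + 3` compares `p(k-2)` with `p(-k-2)`, whose arguments add up to
  -- `-4`.
  have hne := (eventually_ne_of_symmetric hp hc (c' := -4) (by norm_num))
  obtain ⟨K, hK⟩ := eventually_atTop.mp (hg.and (hne.and ((eventually_ge_atTop N).and
    (coeff_two_below_odd_eq_zero hB hp hg))))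
  filter_upwards [eventually_ge_atTop (K + 2)] with k hkK
  obtain ⟨h0, -, hk, h3⟩ := hK k (by omega)
  obtain ⟨h1, -⟩ := hK (k + 1) (by omega)
  obtain ⟨-, h2, -⟩ := hK (k - 2) (by omega)
  have h := hB.odd (k + 1) (by omega) 3
  rw [h1, zero_mul, zero_mul, mul_eq_zero, map_eq_zero] at h
  have hz : A (2 * (k + 1) + 1) 3 = 0 := by
    refine h.resolve_left fun h' => h2 ?_
    rw [Nat.cast_sub (by omega)]
    push_cast at h' ⊢
    rw [← sub_eq_zero, ← h']
    congr 2 <;> ring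
  have e1 := hA.step (2 * (k + 1)) 3
  have e2 := hA.step (2 * k + 1) 2
  have e3 := hA.coeff_one (2 * k)
  rw [hz, h1, zero_mul, add_zero] at e1
  have e4 : ((2 * k + 1 : ℕ) : ℤ) - 2 = 2 * k - 1 := by push_cast; ring
  rw [e4, h3, map_zero, mul_zero, add_zero] at e2
  rw [h0, zero_mul, add_zero] at e3
  rw [← e3]
  norm_num at e1 e2
  rw [← e2]
  exact e1.symm

/-- The constant coefficients eventually vanish. -/
lemma eventually_coeff_zero_eq_zero (hA : IsSzegoArray A) (hB : IsBispectralArray p N A)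
    (hp : 0 < p.natDegree) (hmonic : p.Monic) :
    ∃ K, ∀ n, K ≤ n → A n 0 = 0 := by
  suffices h : (∀ᶠ k : ℕ in atTop, A (2 * k) 0 = 0) ∧ ∀ᶠ k : ℕ in atTop, A (2 * k + 1) 0 = 0 by
    obtain ⟨K, hK⟩ := eventually_atTop.mp (h.1.and h.2)
    refine ⟨2 * K, fun n hn => ?_⟩
    obtain ⟨k, rfl | rfl⟩ := n.even_or_odd'
    · exact (hK k (by omega)).1
    · exact (hK k (by omega)).2
  have hs := eventually_subdiag_eq_zero hA hB hp hmonic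
  have hB' : ∀ᶠ k : ℕ in atTop,
      conj (p.eval (k - 1 : ℂ) - p.eval (-k - 1 : ℂ)) * A (2 * k) 0 = 0 := by
    filter_upwards [hs, eventually_ge_atTop N] with k h0 hk
    rw [coeff_zero_odd_relation hA hB hk, h0]; simp
  have hD' : ∀ᶠ k : ℕ in atTop,
      A (2 * k + 1) (2 * k) * conj (p.eval (k : ℂ) - p.eval (-k : ℂ)) = 0 := by
    filter_upwards [hs, eventually_ge_atTop N] with k h0 hk
    rw [subdiag_odd_relation hA hB hk, h0]; simp
  have shift : (∀ᶠ k : ℕ in atTop, A (2 * k) 0 = 0) → ∀ᶠ k : ℕ in atTop, A (2 * k + 2) 0 = 0 :=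
    fun h => (tendsto_add_atTop_nat 1).eventually h
  have hgeven : (∀ᶠ k : ℕ in atTop, p.eval (k : ℂ) ≠ p.eval (-2 - k : ℂ)) →
      ∀ᶠ k : ℕ in atTop, A (2 * k) 0 = 0 := by
    intro h
    obtain ⟨K, hK⟩ := eventually_atTop.mp h
    filter_upwards [hB', eventually_ge_atTop (K + 1)] with k h1 hk
    have h2 := hK (k - 1) (by omega)
    refine (mul_eq_zero.mp h1).resolve_left fun h' => h2 ?_
    rw [map_eq_zero] at h'
    rw [Nat.cast_sub (by omega), ← sub_eq_zero, ← h']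
    push_cast
    congr 2; ring
  have hgodd : (∀ᶠ k : ℕ in atTop, p.eval (k : ℂ) ≠ p.eval (1 - k : ℂ)) →
      (∀ᶠ k : ℕ in atTop, A (2 * k + 2) 0 * conj (A (2 * k + 1) (2 * k)) = 0) →
      ∀ᶠ k : ℕ in atTop, A (2 * k + 1) 0 = 0 := by
    intro h hz
    filter_upwards [(tendsto_add_atTop_nat 1).eventually h, hz, eventually_ge_atTop N]
      with k h1 h2 hk
    have h3 := coeff_zero_even_relation hA hB hk
    rw [h2, zero_mul] at h3
    refine (mul_eq_zero.mp h3).resolve_left fun h' => h1 ?_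
    push_cast
    rw [← sub_eq_zero, ← h']
    congr 2; ring
  -- The three factors to be cancelled vanish identically exactly when `p(t) = p(c - t)` with `c =
  -- 0`, `-2` or `1`; at most one of these holds. For `c = 0` the even constant coefficients vanish
  -- first and replace the missing information on `s₂ₖ₊₁`. For `c = -2` or `1` the coefficient of
  -- `z³` is needed.
  rcases symmetric_or_eventually_ne p 0 with h0 | h0
  · have he := hgeven (eventually_ne_of_symmetric hp h0 (by norm_num))
    refine ⟨he, hgodd (eventually_ne_of_symmetric hp h0 (by norm_num)) ?_⟩
    filter_upwards [shift he] with k hk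
    rw [hk, zero_mul]
  · have hs' : ∀ᶠ k : ℕ in atTop, A (2 * k + 2) 0 * conj (A (2 * k + 1) (2 * k)) = 0 := by
      filter_upwards [hD', h0] with k h1 h2
      have := (mul_eq_zero.mp h1).resolve_right fun h' => h2 (by
        rw [map_eq_zero, sub_eq_zero] at h'
        rw [h', zero_sub])
      rw [this, map_zero, mul_zero]
    rcases symmetric_or_eventually_ne p (-2) with h2 | h2
    · have ho := hgodd (eventually_ne_of_symmetric hp h2 (by norm_num)) hs'
      exact ⟨coeff_zero_even_eq_zero_of_odd hA hB hp h2 ho, ho⟩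
    · have he := hgeven h2
      refine ⟨he, ?_⟩
      rcases symmetric_or_eventually_ne p 1 with h1 | h1
      · exact coeff_zero_odd_eq_zero_of_even hA hB hp h1 (shift he)
      · exact hgodd h1 hs'

/-- A bispectral Szegő array is the array of the polynomials `z ^ n`. -/
theorem IsBispectralArray.eq_ite (hB : IsBispectralArray p N A) (hA : IsSzegoArray A)
    (hp : 0 < p.natDegree) (n : ℕ) (j : ℤ) : A n j = if j = n then 1 else 0 := by
  have hlc : p.leadingCoeff ≠ 0 := by
    rw [Polynomial.leadingCoeff_ne_zero]; rintro rfl; simp at hp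
  obtain ⟨K, hK⟩ := eventually_coeff_zero_eq_zero hA (hB.smul p.leadingCoeff⁻¹)
    (by rwa [Polynomial.natDegree_C_mul (inv_ne_zero hlc)])
    (by rw [mul_comm]; exact Polynomial.monic_mul_leadingCoeff_inv (by rintro rfl; simp at hp))
  -- With zero constant coefficients the recurrence is multiplication by `z`, so coefficients
  -- counted from the top do not change.
  have hshift : ∀ n, K ≤ n → ∀ i : ℤ, A n (n - i) = A K (K - i) := by
    intro n hn
    induction n, hn using Nat.le_induction with
    | base => intro i; rfl
    | succ n hn ih =>
      intro i
      rw [hA.step, hK (n + 1) (by omega), zero_mul, add_zero, ← ih i]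
      congr 1; push_cast; ring
  -- The same coefficient occurs in all later even rows, where it is multiplied by `p(k+1-i) -
  -- p(k+1)`; this is nonzero for large `k`.
  have hbase : ∀ i : ℤ, i ≠ 0 → A K (K - i) = 0 := by
    intro i hi
    have hne := (tendsto_add_atTop_nat 1).eventually (eventually_eval_add_ne hp (i := -(i : ℂ))
      (neg_ne_zero.mpr (Int.cast_ne_zero.mpr hi)))
    obtain ⟨k, h1, h2, h3⟩ := (hne.and ((eventually_ge_atTop N).and
      (eventually_ge_atTop K))).exists
    have h := hB.even k h2 ((2 * k + 2 : ℕ) - i)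
    rw [hK (2 * k + 2) (by omega), hshift _ (by omega), zero_mul, zero_mul, mul_eq_zero] at h
    refine h.resolve_left fun h' => h1 ?_
    push_cast at h' ⊢
    rw [← sub_eq_zero, ← h']
    congr 2; ring
  have hall : ∀ n, ∀ j : ℤ, A (n + K) j = if j = (n + K : ℕ) then 1 else 0 := by
    intro n j
    have h1 := hshift (n + K) (by omega) ((n + K : ℕ) - j)
    rw [sub_sub_cancel] at h1
    rw [h1]
    split_ifs with h
    · rw [h, sub_self, sub_zero, hA.diag]
    · exact hbase _ (by omega)
  -- If row `l + 1` is a pure power, its constant coefficient is zero, and the recurrence read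
  -- backwards gives row `l`.
  have hdown : ∀ m, m ≤ K → ∀ j : ℤ, A (K - m) j = if j = (K - m : ℕ) then 1 else 0 := by
    intro m
    induction m with
    | zero => intro _ j; simpa using hall 0 j
    | succ m ih =>
      intro hm j
      obtain ⟨l, hl⟩ : ∃ l, K - m = l + 1 := ⟨K - m - 1, by omega⟩
      have e : K - (m + 1) = l := by omega
      rw [e]
      have ih' := ih (by omega)
      rw [hl] at ih'
      have hs := hA.step l (j + 1)
      rw [ih' 0, if_neg (by omega), zero_mul, add_zero, add_sub_cancel_right, ih'] at hs
      rw [← hs]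
      refine if_congr ?_ rfl rfl
      push_cast
      omega
  rcases le_total K n with h | h
  · simpa [Nat.sub_add_cancel h] using hall (n - K) j
  · simpa [Nat.sub_sub_self h] using hdown (K - n) (by omega) j

end Vanishing

/-! ### Differential operators on Laurent polynomials -/

lemma coeff_mul_T (f : ℂ[T;T⁻¹]) (n i : ℤ) :
    (f * LaurentPolynomial.T n).coeff i = f.coeff (i - n) := by
  rw [LaurentPolynomial.T, AddMonoidAlgebra.coeff_mul_single_eq_coeff_mul (i - n), mul_one]
  intro m _
  constructor <;> intro h <;> omega

lemma coeff_C_mul (c : ℂ) (f : ℂ[T;T⁻¹]) (i : ℤ) :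
    (LaurentPolynomial.C c * f).coeff i = c * f.coeff i := by
  rw [← LaurentPolynomial.smul_eq_C_mul]; rfl

lemma ev_T (z : ℂˣ) (n : ℤ) : ev z (LaurentPolynomial.T n) = (z : ℂ) ^ n := by
  simp [ev]

lemma ev_C (z : ℂˣ) (c : ℂ) : ev z (LaurentPolynomial.C c) = c := by
  simp [ev]

lemma ev_smul (z : ℂˣ) (c : ℂ) (f : ℂ[T;T⁻¹]) : ev z (c • f) = c * ev z f := by
  rw [LaurentPolynomial.smul_eq_C_mul, map_mul, ev_C]

lemma ev_injective {f g : ℂ[T;T⁻¹]} (h : ∀ z, ev z f = ev z g) : f = g := by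
  rw [← sub_eq_zero]
  set u := f - g with hu
  have hz : ∀ z, ev z u = 0 := fun z => by rw [hu, map_sub, h z, sub_self]
  obtain ⟨n, q, hq⟩ := LaurentPolynomial.exists_T_pow u
  have hq0 : q = 0 := by
    refine Polynomial.eq_zero_of_infinite_isRoot _ ?_
    refine (Set.infinite_range_of_injective
      (f := fun k : ℕ => ((k + 1 : ℕ) : ℂ)) ?_).mono ?_
    · intro a b hab
      have := Nat.cast_injective (R := ℂ) hab
      omega
    · rintro _ ⟨k, rfl⟩
      have h1 := hz (Units.mk0 ((k + 1 : ℕ) : ℂ) (Nat.cast_ne_zero.mpr (by omega)))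
      have h2 := congrArg (ev (Units.mk0 ((k + 1 : ℕ) : ℂ) (Nat.cast_ne_zero.mpr (by omega)))) hq
      rw [map_mul, h1, zero_mul] at h2
      simpa [ev, Polynomial.IsRoot] using h2
  rw [hq0, map_zero] at hq
  have h3 : u * LaurentPolynomial.T n * LaurentPolynomial.T (-n) = 0 := by rw [← hq, zero_mul]
  rwa [LaurentPolynomial.mul_T_assoc, add_neg_cancel, LaurentPolynomial.T_zero, mul_one] at h3

lemma coeff_ddz (f : ℂ[T;T⁻¹]) (i : ℤ) : (ddz f).coeff i = (i + 1) * f.coeff (i + 1) := by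
  simp only [ddz, Finsupp.sum, AddMonoidAlgebra.coeff_sum, Finsupp.finsetSum_apply, coeff_C_mul,
    LaurentPolynomial.T_apply]
  rw [Finset.sum_eq_single (i + 1)]
  · simp
  · intro b _ hb
    rw [if_neg (by omega), mul_zero]
  · intro h
    simp [Finsupp.notMem_support_iff.mp h]

lemma ddz_iterate_T (k : ℕ) (j : ℤ) :
    ddz^[k] (LaurentPolynomial.T j : ℂ[T;T⁻¹]) =
      (descPochhammer ℂ k).eval (j : ℂ) • LaurentPolynomial.T (j - k) := by
  induction k with
  | zero => simp
  | succ k ih =>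
    rw [Function.iterate_succ_apply', ih]
    ext i
    rw [coeff_ddz, descPochhammer_succ_eval]
    simp only [AddMonoidAlgebra.coeff_smul, Finsupp.smul_apply, LaurentPolynomial.T_apply,
      smul_eq_mul]
    by_cases h : j - k = i + 1
    · rw [if_pos h, if_pos (by push_cast; omega)]
      have : (i : ℂ) + 1 = j - k := by exact_mod_cast h.symm
      rw [this]; ring
    · rw [if_neg h, if_neg (by push_cast; omega)]; ring

lemma IsDiffOp.ev_T_neg_mul {r : ℕ} {D : ℂ[T;T⁻¹] →ₗ[ℂ] ℂ[T;T⁻¹]} {a : ℕ → ℂˣ → ℂ}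
    (h : ∀ (f : ℂ[T;T⁻¹]) (z : ℂˣ),
      ev z (D f) = ∑ k ∈ Finset.range (r + 1), a k z * ev z (ddz^[k] f)) (j : ℤ) (z : ℂˣ) :
    ev z (D (LaurentPolynomial.T j) * LaurentPolynomial.T (-j)) =
      ∑ k ∈ Finset.range (r + 1),
        (descPochhammer ℂ k).eval (j : ℂ) * (a k z * (z : ℂ) ^ (-(k : ℤ))) := by
  rw [map_mul, h, Finset.sum_mul]
  refine Finset.sum_congr rfl fun k _ => ?_
  rw [ddz_iterate_T, ev_smul, ev_T, ev_T, sub_eq_add_neg, zpow_add₀ z.ne_zero]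
  have : (z : ℂ) ^ j * (z : ℂ) ^ (-j) = 1 := by
    rw [← zpow_add₀ z.ne_zero, add_neg_cancel, zpow_zero]
  linear_combination (a k z * (descPochhammer ℂ k).eval (j : ℂ) * (z : ℂ) ^ (-(k : ℤ))) * this

/-- The coefficients of a differential operator mapping Laurent polynomials to Laurent polynomials
are Laurent polynomials. -/
lemma exists_laurent_coeff {r : ℕ} {D : ℂ[T;T⁻¹] →ₗ[ℂ] ℂ[T;T⁻¹]} {a : ℕ → ℂˣ → ℂ}
    (h : ∀ (f : ℂ[T;T⁻¹]) (z : ℂˣ),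
      ev z (D f) = ∑ k ∈ Finset.range (r + 1), a k z * ev z (ddz^[k] f)) (k : ℕ) (hk : k ≤ r) :
    ∃ B : ℂ[T;T⁻¹], ∀ z : ℂˣ, ev z B = a k z * (z : ℂ) ^ (-(k : ℤ)) := by
  induction k using Nat.strong_induction_on with
  | _ k ih =>
    have ih' : ∀ i : Fin k, ∃ B : ℂ[T;T⁻¹], ∀ z : ℂˣ, ev z B = a i z * (z : ℂ) ^ (-(i : ℤ)) :=
      fun i => ih i i.2 (by omega)
    choose B hB using ih'
    -- Applying `D` to `zᵏ` gives a triangular system: derivatives of order above `k` kill `zᵏ`, and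
    -- the `k`-th contributes the factor `k!`.
    refine ⟨((k.factorial : ℂ)⁻¹) • (D (LaurentPolynomial.T k) * LaurentPolynomial.T (-k) -
      ∑ i : Fin k, (descPochhammer ℂ i).eval (k : ℂ) • B i), fun z => ?_⟩
    have hsum := IsDiffOp.ev_T_neg_mul h k z
    rw [ev_smul, map_sub, hsum, map_sum]
    simp only [ev_smul, hB]
    rw [Fin.sum_univ_eq_sum_range
      (fun i => (descPochhammer ℂ i).eval (k : ℂ) * (a i z * (z : ℂ) ^ (-(i : ℤ)))) k]
    have hsub : Finset.range (k + 1) ⊆ Finset.range (r + 1) :=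
      Finset.range_subset_range.mpr (by omega)
    rw [← Finset.sum_subset hsub, Finset.sum_range_succ]
    · push_cast
      rw [add_sub_cancel_left, descPochhammer_eval_eq_descFactorial, Nat.descFactorial_self,
        inv_mul_cancel_left₀ (Nat.cast_ne_zero.mpr k.factorial_ne_zero)]
    · intro i _ hi
      rw [Finset.mem_range, not_lt] at hi
      rw [Int.cast_natCast, descPochhammer_eval_coe_nat_of_lt (by omega), zero_mul]

/-- The symbol of a differential operator: `D zʲ = ∑ₘ Pₘ(j) zʲ⁺ᵐ` with polynomials `Pₘ`. -/
lemma IsDiffOp.exists_symbol {r : ℕ} {D : ℂ[T;T⁻¹] →ₗ[ℂ] ℂ[T;T⁻¹]} (hD : IsDiffOp r D) :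
    ∃ P : ℤ → Polynomial ℂ, (∃ m, (P m).coeff r ≠ 0) ∧
      ∀ j m : ℤ, (D (LaurentPolynomial.T j)).coeff (j + m) = (P m).eval (j : ℂ) := by
  obtain ⟨a, har, h⟩ := hD
  have hex : ∀ k : ℕ, ∃ B : ℂ[T;T⁻¹], k ≤ r → ∀ z : ℂˣ, ev z B = a k z * (z : ℂ) ^ (-(k : ℤ)) := by
    intro k
    by_cases hk : k ≤ r
    · obtain ⟨B, hB⟩ := exists_laurent_coeff h k hk
      exact ⟨B, fun _ => hB⟩
    · exact ⟨0, fun h => absurd h hk⟩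
  choose B hB using hex
  refine ⟨fun m => ∑ k ∈ Finset.range (r + 1),
    Polynomial.C ((B k).coeff m) * descPochhammer ℂ k, ?_, fun j m => ?_⟩
  · have hBr : B r ≠ 0 := by
      rintro h0
      refine har (funext fun z => ?_)
      have := hB r le_rfl z
      rw [h0, map_zero] at this
      exact (mul_eq_zero.mp this.symm).resolve_right (zpow_ne_zero _ z.ne_zero)
    obtain ⟨m, hm⟩ : ∃ m, (B r).coeff m ≠ 0 := by
      by_contra! hc
      exact hBr (LaurentPolynomial.ext fun i => hc i)
    refine ⟨m, ?_⟩
    rw [Polynomial.finsetSum_coeff, Finset.sum_range_succ, Finset.sum_eq_zero, zero_add,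
      Polynomial.coeff_C_mul]
    · have h1 := (monic_descPochhammer ℂ r).coeff_natDegree
      rw [descPochhammer_natDegree] at h1
      rw [h1, mul_one]
      exact hm
    · intro k hk
      rw [Polynomial.coeff_C_mul, Polynomial.coeff_eq_zero_of_natDegree_lt, mul_zero]
      rw [descPochhammer_natDegree]
      exact Finset.mem_range.mp hk
  · have hDT : D (LaurentPolynomial.T j) * LaurentPolynomial.T (-j) =
        ∑ k ∈ Finset.range (r + 1), (descPochhammer ℂ k).eval (j : ℂ) • B k := by
      refine ev_injective fun z => ?_
      rw [IsDiffOp.ev_T_neg_mul h, map_sum]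
      refine Finset.sum_congr rfl fun k hk => ?_
      rw [ev_smul, hB k (by have := Finset.mem_range.mp hk; omega)]
    have h1 := congrArg (fun f : ℂ[T;T⁻¹] => f.coeff m) hDT
    simp only [coeff_mul_T, AddMonoidAlgebra.coeff_sum, Finsupp.finsetSum_apply,
      AddMonoidAlgebra.coeff_smul, Finsupp.smul_apply, smul_eq_mul] at h1
    rw [sub_neg_eq_add, add_comm] at h1
    rw [h1, Polynomial.eval_finsetSum]
    refine Finset.sum_congr rfl fun k _ => ?_
    rw [Polynomial.eval_mul, Polynomial.eval_C, mul_comm]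

/-- The Euler operator `z d/dz`. -/
def euler : ℂ[T;T⁻¹] →ₗ[ℂ] ℂ[T;T⁻¹] where
  toFun f := ddz f * LaurentPolynomial.T 1
  map_add' f g := by
    ext i
    simp only [coeff_mul_T, coeff_ddz, AddMonoidAlgebra.coeff_add, Finsupp.add_apply]
    ring
  map_smul' c f := by
    ext i
    simp only [coeff_mul_T, coeff_ddz, AddMonoidAlgebra.coeff_smul, Finsupp.smul_apply,
      RingHom.id_apply, smul_eq_mul]
    ring

lemma isDiffOp_euler : IsDiffOp 1 euler := by
  refine ⟨fun k z => if k = 1 then z else 0, fun h => ?_, fun f z => ?_⟩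
  · have := congrFun h 1
    simp at this
  · have h1 : ev z (LaurentPolynomial.T 1) = z := by rw [ev_T, zpow_one]
    simp [euler, h1, mul_comm]

lemma euler_T (j : ℤ) :
    euler (LaurentPolynomial.T j) = (j : ℂ) • (LaurentPolynomial.T j : ℂ[T;T⁻¹]) := by
  ext i
  simp only [euler, LinearMap.coe_mk, AddHom.coe_mk, coeff_mul_T, coeff_ddz,
    LaurentPolynomial.T_apply, AddMonoidAlgebra.coeff_smul, Finsupp.smul_apply, smul_eq_mul]
  by_cases h : j = i
  · subst h; simp
  · rw [if_neg (by omega), if_neg h]; simp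

/-! ### The flag of subspaces spanned by `1, z⁻¹, z, z⁻², z², …` -/

lemma cmvExp_even (k : ℕ) : cmvExp (2 * k) = k := by
  simp [cmvExp]

lemma cmvExp_odd (k : ℕ) : cmvExp (2 * k + 1) = -k - 1 := by
  have h : ¬ Even (2 * k + 1) := by simp
  rw [cmvExp, if_neg h]
  push_cast
  omega

lemma cmvExp_injective : Function.Injective cmvExp := by
  intro m n h
  obtain ⟨k, rfl | rfl⟩ := m.even_or_odd' <;> obtain ⟨l, rfl | rfl⟩ := n.even_or_odd' <;>
    simp only [cmvExp_even, cmvExp_odd] at h <;> omega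

/-- The span of the first `n` of the powers `1, z⁻¹, z, z⁻², z², …`. -/
def flag (n : ℕ) : Submodule ℂ ℂ[T;T⁻¹] where
  carrier := {f | ∀ i, (∀ k < n, cmvExp k ≠ i) → f.coeff i = 0}
  add_mem' {f g} hf hg i hi := by
    simp [hf i hi, hg i hi]
  zero_mem' i _ := by simp
  smul_mem' c f hf i hi := by
    simp [hf i hi]

lemma mem_flag {n : ℕ} {f : ℂ[T;T⁻¹]} :
    f ∈ flag n ↔ ∀ i, (∀ k < n, cmvExp k ≠ i) → f.coeff i = 0 := Iff.rfl

lemma flag_mono {m n : ℕ} (h : m ≤ n) : flag m ≤ flag n :=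
  fun _ hf i hi => hf i fun k hk => hi k (hk.trans_le h)

lemma mem_flag_even {k : ℕ} {f : ℂ[T;T⁻¹]} :
    f ∈ flag (2 * k) ↔ ∀ i : ℤ, (i < -k ∨ (k : ℤ) ≤ i) → f.coeff i = 0 := by
  rw [mem_flag]
  refine forall_congr' fun i => imp_congr_left ⟨fun h => ?_, fun h l hl => ?_⟩
  · by_contra! hc
    rcases le_or_gt 0 i with hi | hi
    · exact h (2 * i.toNat) (by omega) (by rw [cmvExp_even]; omega)
    · exact h (2 * (-i - 1).toNat + 1) (by omega) (by rw [cmvExp_odd]; omega)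
  · obtain ⟨j, rfl | rfl⟩ := l.even_or_odd'
    · rw [cmvExp_even]; omega
    · rw [cmvExp_odd]; omega

lemma mem_flag_odd {k : ℕ} {f : ℂ[T;T⁻¹]} :
    f ∈ flag (2 * k + 1) ↔ ∀ i : ℤ, (i < -k ∨ (k : ℤ) < i) → f.coeff i = 0 := by
  rw [mem_flag]
  refine forall_congr' fun i => imp_congr_left ⟨fun h => ?_, fun h l hl => ?_⟩
  · by_contra! hc
    rcases le_or_gt 0 i with hi | hi
    · exact h (2 * i.toNat) (by omega) (by rw [cmvExp_even]; omega)
    · exact h (2 * (-i - 1).toNat + 1) (by omega) (by rw [cmvExp_odd]; omega)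
  · obtain ⟨j, rfl | rfl⟩ := l.even_or_odd'
    · rw [cmvExp_even]; omega
    · rw [cmvExp_odd]; omega

lemma T_mem_flag (n : ℕ) : (LaurentPolynomial.T (cmvExp n) : ℂ[T;T⁻¹]) ∈ flag (n + 1) := by
  intro i hi
  rw [LaurentPolynomial.T_apply, if_neg (hi n n.lt_succ_self)]

lemma coeff_cmvExp_of_mem_flag {n m : ℕ} (h : n ≤ m) {f : ℂ[T;T⁻¹]} (hf : f ∈ flag n) :
    f.coeff (cmvExp m) = 0 :=
  hf _ fun _ hk e => absurd (cmvExp_injective e) (by omega)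

lemma mem_flag_of_coeff_eq_zero {n : ℕ} {f : ℂ[T;T⁻¹]} (hf : f ∈ flag (n + 1))
    (h : f.coeff (cmvExp n) = 0) : f ∈ flag n := by
  intro i hi
  by_cases hin : cmvExp n = i
  · rw [← hin, h]
  · exact hf i fun k hk => by
      rcases Nat.lt_succ_iff_lt_or_eq.mp hk with h' | rfl
      · exact hi k h'
      · exact hin

lemma span_le_flag (n : ℕ) :
    Submodule.span ℂ ((fun k => (LaurentPolynomial.T (cmvExp k) : ℂ[T;T⁻¹])) '' Set.Iic n) ≤
      flag (n + 1) := by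
  rw [Submodule.span_le]
  rintro _ ⟨k, hk, rfl⟩
  exact flag_mono (Nat.succ_le_succ hk) (T_mem_flag k)

lemma exists_mem_flag (f : ℂ[T;T⁻¹]) : ∃ n, f ∈ flag n := by
  induction f using LaurentPolynomial.induction_on' with
  | add p q hp hq =>
    obtain ⟨m, hm⟩ := hp
    obtain ⟨n, hn⟩ := hq
    exact ⟨max m n, add_mem (flag_mono (le_max_left _ _) hm) (flag_mono (le_max_right _ _) hn)⟩
  | C_mul_T n a =>
    refine ⟨2 * n.natAbs + 1, mem_flag_odd.mpr fun i hi => ?_⟩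
    rw [coeff_C_mul, LaurentPolynomial.T_apply, if_neg (by omega), mul_zero]

/-! ### The involution `f ↦ f#`, which is complex conjugation on the unit circle -/

/-- `∑ cᵢ zⁱ ↦ ∑ conj cᵢ z⁻ⁱ`. -/
def sharp (f : ℂ[T;T⁻¹]) : ℂ[T;T⁻¹] :=
  LaurentPolynomial.invert (AddMonoidAlgebra.mapRingHom ℤ (starRingEnd ℂ) f)

lemma coeff_sharp (f : ℂ[T;T⁻¹]) (i : ℤ) : (sharp f).coeff i = conj (f.coeff (-i)) := by
  simp [sharp]

lemma coe_toUnits (z : Circle) : ((Circle.toUnits z : ℂˣ) : ℂ) = z := rfl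

lemma ev_sharp (z : Circle) (f : ℂ[T;T⁻¹]) :
    ev z.toUnits (sharp f) = conj (ev z.toUnits f) := by
  induction f using LaurentPolynomial.induction_on' with
  | add p q hp hq =>
    rw [map_add, map_add, ← hp, ← hq, ← map_add, sharp, map_add, map_add]; rfl
  | C_mul_T n a =>
    have h : sharp (LaurentPolynomial.C a * LaurentPolynomial.T n) =
        LaurentPolynomial.C (conj a) * LaurentPolynomial.T (-n) := by
      ext i
      rw [coeff_sharp, coeff_C_mul, coeff_C_mul, map_mul, LaurentPolynomial.T_apply,
        LaurentPolynomial.T_apply]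
      by_cases hi : n = -i
      · rw [if_pos hi, if_pos (by omega), map_one]
      · rw [if_neg hi, if_neg (by omega), map_zero]
    rw [h, map_mul, map_mul, map_mul, ev_C, ev_C, ev_T, ev_T, coe_toUnits, map_zpow₀,
      ← Circle.coe_inv_eq_conj, Circle.coe_inv, inv_zpow']

lemma continuous_ev (f : ℂ[T;T⁻¹]) : Continuous fun z : Circle => ev z.toUnits f := by
  induction f using LaurentPolynomial.induction_on' with
  | add p q hp hq =>
    simp only [map_add]
    exact hp.add hq
  | C_mul_T n a =>
    simp only [map_mul, ev_C, ev_T, coe_toUnits]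
    exact continuous_const.mul ((by fun_prop : Continuous fun z : Circle => (z : ℂ)).zpow₀ n
      fun z => Or.inl z.coe_ne_zero)

/-! ### The inner product of `L²(μ)` on Laurent polynomials -/

section Inner

variable (μ : Measure Circle) [IsFiniteMeasure μ]

lemma integrable_ev (f : ℂ[T;T⁻¹]) : Integrable (fun z : Circle => ev z.toUnits f) μ :=
  (continuous_ev f).integrable_of_hasCompactSupport (HasCompactSupport.of_compactSpace _)

lemma ev_mul_conj_ev (f g : ℂ[T;T⁻¹]) (z : Circle) :
    ev z.toUnits f * conj (ev z.toUnits g) = ev z.toUnits (f * sharp g) := by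
  rw [map_mul, ev_sharp]

/-- `f ↦ ∫ f conj g dμ`. -/
def ip (g : ℂ[T;T⁻¹]) : ℂ[T;T⁻¹] →ₗ[ℂ] ℂ where
  toFun f := ∫ z : Circle, ev z.toUnits f * conj (ev z.toUnits g) ∂μ
  map_add' f f' := by
    simp only [ev_mul_conj_ev]
    rw [← integral_add (integrable_ev μ _) (integrable_ev μ _)]
    simp only [add_mul, map_add]
  map_smul' c f := by
    simp only [ev_smul, mul_assoc, integral_const_mul]
    rfl

lemma ip_apply (f g : ℂ[T;T⁻¹]) :
    ip μ g f = ∫ z : Circle, ev z.toUnits f * conj (ev z.toUnits g) ∂μ := rfl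

lemma conj_ip (f g : ℂ[T;T⁻¹]) : conj (ip μ g f) = ip μ f g := by
  rw [ip_apply, ip_apply, ← integral_conj]
  refine integral_congr_ae (Eventually.of_forall fun z => ?_)
  simp [mul_comm]

lemma ip_sharp (f g : ℂ[T;T⁻¹]) : ip μ (sharp g) (sharp f) = ip μ f g := by
  rw [ip_apply, ip_apply]
  refine integral_congr_ae (Eventually.of_forall fun z => ?_)
  simp only [ev_sharp, Complex.conj_conj]
  ring

lemma ip_mul_T (f g : ℂ[T;T⁻¹]) (n : ℤ) :
    ip μ (g * LaurentPolynomial.T n) (f * LaurentPolynomial.T n) = ip μ g f := by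
  rw [ip_apply, ip_apply]
  refine integral_congr_ae (Eventually.of_forall fun z => ?_)
  simp only [map_mul, ev_T, coe_toUnits]
  have h : (z : ℂ) ^ n * conj ((z : ℂ) ^ n) = 1 := by
    rw [Complex.mul_conj, Complex.normSq_eq_norm_sq, norm_zpow, Circle.norm_coe]; simp
  linear_combination (ev z.toUnits f * conj (ev z.toUnits g)) * h

lemma ip_smul_right (c : ℂ) (f g : ℂ[T;T⁻¹]) : ip μ (c • g) f = conj c * ip μ g f := by
  rw [← conj_ip, map_smul, smul_eq_mul, map_mul, conj_ip]

lemma ip_sub_right (f g h : ℂ[T;T⁻¹]) : ip μ (g - h) f = ip μ g f - ip μ h f := by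
  rw [← conj_ip, map_sub, map_sub, conj_ip, conj_ip]

end Inner

/-! ### Orthonormal Laurent polynomials -/

namespace IsOLP

variable {μ : Measure Circle} {x : ℕ → ℂ[T;T⁻¹]}

lemma mem_flag (hx : IsOLP μ x) (n : ℕ) : x n ∈ flag (n + 1) :=
  span_le_flag n (hx.mem_span n)

variable [IsFiniteMeasure μ]

lemma ip_eq (hx : IsOLP μ x) (m n : ℕ) : ip μ (x n) (x m) = if m = n then 1 else 0 :=
  hx.orthonormal m n

/-- The two claims need each other: if `x n` had no leading term it would lie in the previous span
and be orthogonal to itself, contradicting norm one; once it has one, it can be used to reduce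
elements of the next span. -/
lemma lead_ne_zero_and_ip_eq_zero (hx : IsOLP μ x) (n : ℕ) :
    (∀ m < n, (x m).coeff (cmvExp m) ≠ 0) ∧
      ∀ f ∈ flag n, ∀ m, n ≤ m → ip μ (x m) f = 0 := by
  induction n with
  | zero =>
    refine ⟨fun m hm => absurd hm (Nat.not_lt_zero m), fun f hf m _ => ?_⟩
    have : f = 0 := LaurentPolynomial.ext fun i => hf i (by simp)
    rw [this, map_zero]
  | succ n ih =>
    have hn : (x n).coeff (cmvExp n) ≠ 0 := by
      intro h
      have h1 := ih.2 _ (mem_flag_of_coeff_eq_zero (hx.mem_flag n) h) n le_rfl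
      rw [hx.ip_eq, if_pos rfl] at h1
      exact one_ne_zero h1
    refine ⟨fun m hm => ?_, fun f hf m hm => ?_⟩
    · rcases Nat.lt_succ_iff_lt_or_eq.mp hm with h | rfl
      · exact ih.1 m h
      · exact hn
    · set c := f.coeff (cmvExp n) / (x n).coeff (cmvExp n) with hc
      have hf' : f - c • x n ∈ flag n := by
        refine mem_flag_of_coeff_eq_zero
          (sub_mem hf ((flag (n + 1)).smul_mem c (hx.mem_flag n))) ?_
        simp [hc, hn]
      have h1 := ih.2 _ hf' m (by omega)
      rwa [map_sub, map_smul, hx.ip_eq, if_neg (by omega), smul_zero, sub_zero] at h1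

lemma lead_ne_zero (hx : IsOLP μ x) (n : ℕ) : (x n).coeff (cmvExp n) ≠ 0 :=
  (hx.lead_ne_zero_and_ip_eq_zero (n + 1)).1 n n.lt_succ_self

lemma ip_eq_zero (hx : IsOLP μ x) {n : ℕ} {f : ℂ[T;T⁻¹]} (hf : f ∈ flag n) :
    ip μ (x n) f = 0 :=
  (hx.lead_ne_zero_and_ip_eq_zero n).2 f hf n le_rfl

lemma sub_smul_mem_flag (hx : IsOLP μ x) {n : ℕ} {f : ℂ[T;T⁻¹]} (hf : f ∈ flag (n + 1)) :
    f - (f.coeff (cmvExp n) / (x n).coeff (cmvExp n)) • x n ∈ flag n := by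
  refine mem_flag_of_coeff_eq_zero
    (sub_mem hf ((flag (n + 1)).smul_mem _ (hx.mem_flag n))) ?_
  simp [hx.lead_ne_zero n]

/-- Nondegeneracy of the inner product on each span, obtained from the existence of the orthonormal
sequence alone. -/
lemma eq_zero_of_ip_eq_zero (hx : IsOLP μ x) {n : ℕ} {f : ℂ[T;T⁻¹]} (hf : f ∈ flag n)
    (h : ∀ g ∈ flag n, ip μ f g = 0) : f = 0 := by
  induction n with
  | zero => exact LaurentPolynomial.ext fun i => hf i (by simp)
  | succ n ih =>
    refine ih ?_ fun g hg => h g (flag_mono n.le_succ hg)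
    have h1 := hx.sub_smul_mem_flag hf
    have h2 := hx.ip_eq_zero h1
    have h3 : ip μ (x n) f = 0 := by rw [← conj_ip, h _ (hx.mem_flag n), map_zero]
    rw [map_sub, map_smul, hx.ip_eq, if_pos rfl, h3, smul_eq_mul, mul_one, zero_sub,
      neg_eq_zero] at h2
    rwa [h2, zero_smul, sub_zero] at h1

end IsOLP

/-- The multiple of `x n` with leading coefficient `1`. -/
def monicOLP (x : ℕ → ℂ[T;T⁻¹]) (n : ℕ) : ℂ[T;T⁻¹] :=
  ((x n).coeff (cmvExp n))⁻¹ • x n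

/-! ### The Szegő recurrence for monic orthogonal Laurent polynomials -/

section Monic

variable {μ : Measure Circle} {x : ℕ → ℂ[T;T⁻¹]}

lemma monicOLP_mem_flag (hx : IsOLP μ x) (n : ℕ) : monicOLP x n ∈ flag (n + 1) :=
  Submodule.smul_mem _ _ (hx.mem_flag n)

variable [IsFiniteMeasure μ]

lemma coeff_monicOLP (hx : IsOLP μ x) (n : ℕ) : (monicOLP x n).coeff (cmvExp n) = 1 := by
  simp [monicOLP, hx.lead_ne_zero n]

lemma ip_monicOLP_eq_zero (hx : IsOLP μ x) {n : ℕ} {f : ℂ[T;T⁻¹]} (hf : f ∈ flag n) :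
    ip μ (monicOLP x n) f = 0 := by
  rw [monicOLP, ip_smul_right, hx.ip_eq_zero hf, mul_zero]

lemma exists_ip_monicOLP_self (hx : IsOLP μ x) (n : ℕ) :
    ∃ ρ : ℝ, 0 < ρ ∧ ip μ (monicOLP x n) (monicOLP x n) = ρ := by
  refine ⟨Complex.normSq ((x n).coeff (cmvExp n))⁻¹,
    Complex.normSq_pos.mpr (inv_ne_zero (hx.lead_ne_zero n)), ?_⟩
  rw [monicOLP, ip_smul_right, map_smul, hx.ip_eq, if_pos rfl, Complex.normSq_eq_conj_mul_self,
    smul_eq_mul, mul_one]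

/-- Pythagoras: `‖w‖² = ‖v‖² = ‖u‖² + |c|² ‖w‖²` with `‖u‖ > 0`. -/
lemma norm_lt_one_of_orthogonal {u v w : ℂ[T;T⁻¹]} {c : ℂ} (h : u = v + c • w)
    (huw : ip μ u w = 0) (hvw : ip μ v v = ip μ w w) {ρ ρ' : ℝ} (hρ' : 0 < ρ')
    (hw : ip μ w w = ρ) (hρ : 0 < ρ) (hu : ip μ u u = ρ') : ‖c‖ < 1 := by
  have hv : v = u - c • w := by rw [h, add_sub_cancel_right]
  have hwu : ip μ w u = 0 := by rw [← conj_ip, huw, map_zero]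
  rw [hv, ip_sub_right, map_sub, map_sub, ip_smul_right, ip_smul_right, map_smul, map_smul, huw,
    hwu, hu, hw] at hvw
  have h1 : ((ρ' + Complex.normSq c * ρ : ℝ) : ℂ) = ρ := by
    rw [← hvw]
    push_cast
    rw [Complex.normSq_eq_conj_mul_self]
    simp only [smul_eq_mul]
    ring
  have h2 := Complex.ofReal_injective h1
  rw [Complex.normSq_eq_norm_sq] at h2
  by_contra! hc
  have h3 := le_mul_of_one_le_left hρ.le (one_le_pow₀ hc (n := 2))
  linarith

/-- The involution `sharp` preserves the span of `z⁻ᵏ, …, zᵏ`. The difference of the two sides lies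
in that span, its two outer coefficients cancelling, and is orthogonal to it. -/
lemma monicOLP_even (hx : IsOLP μ x) (k : ℕ) :
    monicOLP x (2 * k + 2) = sharp (monicOLP x (2 * k + 1)) +
      (monicOLP x (2 * k + 2)).coeff (-k - 1) • monicOLP x (2 * k + 1) := by
  have m1 := mem_flag_odd.mp (monicOLP_mem_flag hx (2 * (k + 1)))
  have m2 := (mem_flag_even (k := k + 1)).mp (monicOLP_mem_flag hx (2 * k + 1))
  have c1 := coeff_monicOLP hx (2 * (k + 1))
  have c2 := coeff_monicOLP hx (2 * k + 1)
  rw [cmvExp_even] at c1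
  rw [cmvExp_odd] at c2
  rw [show 2 * (k + 1) = 2 * k + 2 by ring] at m1 c1
  push_cast at m1 m2 c1
  rw [← sub_eq_zero, ← sub_sub]
  refine hx.eq_zero_of_ip_eq_zero (n := 2 * k + 1) (mem_flag_odd.mpr fun i hi => ?_)
    fun g hg => ?_
  · simp only [AddMonoidAlgebra.coeff_sub, AddMonoidAlgebra.coeff_smul, Finsupp.sub_apply,
      Finsupp.smul_apply, coeff_sharp, smul_eq_mul]
    rcases eq_or_ne i (k + 1) with rfl | h1
    · rw [c1, neg_add', c2, m2 (k + 1) (by omega)]; simp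
    rcases eq_or_ne i (-k - 1) with rfl | h2
    · rw [c2, m2 (-(-k - 1)) (by omega)]; simp
    · rw [m1 i (by omega), m2 i (by omega), m2 (-i) (by omega)]; simp
  · have hg' : sharp g ∈ flag (2 * k + 1) := by
      refine mem_flag_odd.mpr fun i hi => ?_
      rw [coeff_sharp, mem_flag_odd.mp hg (-i) (by omega), map_zero]
    have h3 : ip μ (sharp (monicOLP x (2 * k + 1))) g = 0 := by
      have e : g = sharp (sharp g) := by ext i; simp [coeff_sharp]
      rw [e, ip_sharp, ← conj_ip, ip_monicOLP_eq_zero hx hg', map_zero]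
    rw [ip_sub_right, ip_sub_right, ip_smul_right,
      ip_monicOLP_eq_zero hx (flag_mono (by omega) hg), ip_monicOLP_eq_zero hx hg, h3]
    simp

/-- As for even indices, with the reflection `f ↦ f# z⁻¹`, which preserves the span of `z⁻ᵏ, …,
zᵏ⁻¹`. -/
lemma monicOLP_odd (hx : IsOLP μ x) (k : ℕ) :
    monicOLP x (2 * k + 1) = sharp (monicOLP x (2 * k)) * LaurentPolynomial.T (-1) +
      (monicOLP x (2 * k + 1)).coeff k • monicOLP x (2 * k) := by
  have m1 := (mem_flag_even (k := k + 1)).mp (monicOLP_mem_flag hx (2 * k + 1))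
  have m2 := mem_flag_odd.mp (monicOLP_mem_flag hx (2 * k))
  have c1 := coeff_monicOLP hx (2 * k + 1)
  have c2 := coeff_monicOLP hx (2 * k)
  rw [cmvExp_odd] at c1
  rw [cmvExp_even] at c2
  push_cast at m1
  rw [← sub_eq_zero, ← sub_sub]
  refine hx.eq_zero_of_ip_eq_zero (n := 2 * k) (mem_flag_even.mpr fun i hi => ?_)
    fun g hg => ?_
  · simp only [AddMonoidAlgebra.coeff_sub, AddMonoidAlgebra.coeff_smul, Finsupp.sub_apply,
      Finsupp.smul_apply, coeff_sharp, coeff_mul_T, smul_eq_mul, sub_neg_eq_add]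
    rcases eq_or_ne i k with rfl | h1
    · rw [c2, m2 (-(k + 1)) (by omega)]; simp
    rcases eq_or_ne i (-k - 1) with rfl | h2
    · rw [c1, sub_add_cancel, neg_neg, c2, m2 (-k - 1) (by omega)]; simp
    · rw [m1 i (by omega), m2 i (by omega), m2 (-(i + 1)) (by omega)]; simp
  · have hg' : sharp (g * LaurentPolynomial.T 1) ∈ flag (2 * k) := by
      refine mem_flag_even.mpr fun i hi => ?_
      rw [coeff_sharp, coeff_mul_T, mem_flag_even.mp hg (-i - 1) (by omega), map_zero]
    have h3 : ip μ (sharp (monicOLP x (2 * k)) * LaurentPolynomial.T (-1)) g = 0 := by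
      have e : g = sharp (sharp (g * LaurentPolynomial.T 1)) * LaurentPolynomial.T (-1) := by
        ext i; simp [coeff_sharp, coeff_mul_T]
      rw [e, ip_mul_T, ip_sharp, ← conj_ip, ip_monicOLP_eq_zero hx hg', map_zero]
    rw [ip_sub_right, ip_sub_right, ip_smul_right,
      ip_monicOLP_eq_zero hx (flag_mono (by omega) hg), ip_monicOLP_eq_zero hx hg, h3]
    simp

end Monic

/-- The coefficients of the monic orthogonal polynomials on the unit circle belonging to the
orthonormal Laurent polynomials `x`. -/
def szegoArray (x : ℕ → ℂ[T;T⁻¹]) (n : ℕ) (j : ℤ) : ℂ :=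
  if Even n then (monicOLP x n).coeff (j - (n / 2 : ℕ))
  else conj ((monicOLP x n).coeff ((n / 2 : ℕ) - j))

lemma szegoArray_even (x : ℕ → ℂ[T;T⁻¹]) (k : ℕ) (j : ℤ) :
    szegoArray x (2 * k) j = (monicOLP x (2 * k)).coeff (j - k) := by
  rw [szegoArray, if_pos (even_two_mul k), Nat.mul_div_cancel_left k two_pos]

lemma szegoArray_even_succ (x : ℕ → ℂ[T;T⁻¹]) (k : ℕ) (j : ℤ) :
    szegoArray x (2 * k + 2) j = (monicOLP x (2 * k + 2)).coeff (j - k - 1) := by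
  rw [show 2 * k + 2 = 2 * (k + 1) by ring, szegoArray_even]
  congr 1; push_cast; ring

lemma szegoArray_odd (x : ℕ → ℂ[T;T⁻¹]) (k : ℕ) (j : ℤ) :
    szegoArray x (2 * k + 1) j = conj ((monicOLP x (2 * k + 1)).coeff (k - j)) := by
  have h : (2 * k + 1) / 2 = k := by omega
  rw [szegoArray, if_neg (by simp), h]

lemma isSzegoArray {μ : Measure Circle} [IsFiniteMeasure μ] {x : ℕ → ℂ[T;T⁻¹]}
    (hx : IsOLP μ x) : IsSzegoArray (szegoArray x) where
  diag n := by
    have h := coeff_monicOLP hx n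
    obtain ⟨k, rfl | rfl⟩ := n.even_or_odd'
    · rw [cmvExp_even] at h
      rw [szegoArray_even, ← h]
      congr 1; push_cast; ring
    · rw [cmvExp_odd] at h
      rw [szegoArray_odd, ← map_one (starRingEnd ℂ), ← h]
      congr 2; push_cast; ring
  of_neg n j hj := by
    have h := monicOLP_mem_flag hx n
    obtain ⟨k, rfl | rfl⟩ := n.even_or_odd'
    · rw [szegoArray_even]
      exact mem_flag_odd.mp h _ (by omega)
    · rw [szegoArray_odd, map_eq_zero]
      exact (mem_flag_even (k := k + 1)).mp h _ (by push_cast; omega)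
  step n j := by
    obtain ⟨k, rfl | rfl⟩ := n.even_or_odd'
    · rw [szegoArray_odd, szegoArray_odd, szegoArray_even, szegoArray_even]
      conv_lhs => rw [monicOLP_odd hx k]
      simp only [AddMonoidAlgebra.coeff_add, AddMonoidAlgebra.coeff_smul, Finsupp.add_apply,
        Finsupp.smul_apply, coeff_mul_T, coeff_sharp, smul_eq_mul, map_add, map_mul,
        Complex.conj_conj, sub_zero]
      congr 2
      · ring_nf
      · congr 2; push_cast; ring
    · rw [show 2 * k + 1 + 1 = 2 * k + 2 by ring, szegoArray_even_succ, szegoArray_even_succ,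
        szegoArray_odd, szegoArray_odd]
      conv_lhs => rw [monicOLP_even hx k]
      simp only [AddMonoidAlgebra.coeff_add, AddMonoidAlgebra.coeff_smul, Finsupp.add_apply,
        Finsupp.smul_apply, coeff_sharp, smul_eq_mul, Complex.conj_conj]
      congr 2
      · congr 2; ring
      · congr 1; ring
      · congr 1; push_cast; ring
  norm_lt n := by
    obtain ⟨ρ, hρ, h⟩ := exists_ip_monicOLP_self hx n
    obtain ⟨ρ', hρ', h'⟩ := exists_ip_monicOLP_self hx (n + 1)
    have horth : ip μ (monicOLP x (n + 1)) (monicOLP x n) = 0 :=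
      ip_monicOLP_eq_zero hx (monicOLP_mem_flag hx n)
    obtain ⟨k, rfl | rfl⟩ := n.even_or_odd'
    · rw [szegoArray_odd, RCLike.norm_conj, sub_zero]
      exact norm_lt_one_of_orthogonal (monicOLP_odd hx k) horth
        (by rw [ip_mul_T, ip_sharp]) hρ' h hρ h'
    · rw [show 2 * k + 1 + 1 = 2 * k + 2 by ring, szegoArray_even_succ, zero_sub]
      exact norm_lt_one_of_orthogonal (monicOLP_even hx k) horth
        (by rw [ip_sharp]) hρ' h hρ h'

/-! ### Differential operators acting on orthonormal Laurent polynomials -/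

section Bispectral

variable {μ : Measure Circle} [IsFiniteMeasure μ] {x : ℕ → ℂ[T;T⁻¹]}
  {D : ℂ[T;T⁻¹] →ₗ[ℂ] ℂ[T;T⁻¹]} {n₀ : ℕ}

lemma exists_forall_map_mem_flag (hx : IsOLP μ x) (D : ℂ[T;T⁻¹] →ₗ[ℂ] ℂ[T;T⁻¹]) (n : ℕ) :
    ∃ N, ∀ f ∈ flag n, D f ∈ flag N := by
  induction n with
  | zero =>
    refine ⟨0, fun f hf => ?_⟩
    have : f = 0 := LaurentPolynomial.ext fun i => hf i (by simp)
    rw [this, map_zero]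
    exact zero_mem _
  | succ n ih =>
    obtain ⟨N, hN⟩ := ih
    obtain ⟨M, hM⟩ := exists_mem_flag (D (x n))
    refine ⟨max N M, fun f hf => ?_⟩
    have h := hN _ (hx.sub_smul_mem_flag hf)
    rw [map_sub, map_smul] at h
    have h2 := add_mem (flag_mono (le_max_left N M) h)
      ((flag (max N M)).smul_mem (f.coeff (cmvExp n) / (x n).coeff (cmvExp n))
        (flag_mono (le_max_right N M) hM))
    rwa [sub_add_cancel] at h2

/-- The finitely many `x n` with `n < n₀` have images in one fixed span, which is absorbed as soon
as `n` is large. -/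
lemma exists_map_mem_flag_succ (hx : IsOLP μ x)
    (hD : ∀ n ≥ n₀, D (x n) ∈ Submodule.span ℂ {x (n - 1), x n, x (n + 1)}) :
    ∃ N, ∀ n, N ≤ n → ∀ f ∈ flag n, D f ∈ flag (n + 1) := by
  obtain ⟨M, hM⟩ := exists_forall_map_mem_flag hx D n₀
  have key : ∀ n, n₀ ≤ n → ∀ f ∈ flag n, D f ∈ flag (max M (n + 1)) := by
    intro n hn
    induction n, hn using Nat.le_induction with
    | base => exact fun f hf => flag_mono (le_max_left _ _) (hM f hf)
    | succ n hn ih =>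
      intro f hf
      have h := ih _ (hx.sub_smul_mem_flag hf)
      rw [map_sub, map_smul] at h
      have hle : Submodule.span ℂ {x (n - 1), x n, x (n + 1)} ≤ flag (n + 1 + 1) := by
        rw [Submodule.span_le]
        rintro _ (rfl | rfl | rfl)
        · exact flag_mono (by omega) (hx.mem_flag (n - 1))
        · exact flag_mono (by omega) (hx.mem_flag n)
        · exact hx.mem_flag (n + 1)
      have h2 := add_mem (flag_mono (max_le_max_left M (by omega : n + 1 ≤ n + 1 + 1)) h)
        ((flag (max M (n + 1 + 1))).smul_mem (f.coeff (cmvExp n) / (x n).coeff (cmvExp n))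
          (flag_mono (le_max_right M _) (hle (hD n hn))))
      rwa [sub_add_cancel] at h2
  refine ⟨max M n₀, fun n hn f hf => ?_⟩
  have h := key n (by omega) f hf
  rwa [max_eq_right (by omega)] at h

/-- A differential operator whose matrix in the basis `x` is eventually tridiagonal is a polynomial
in `z d/dz`. -/
lemma exists_diagonal_symbol (hx : IsOLP μ x) {r : ℕ} (hr : 1 ≤ r) (hDr : IsDiffOp r D)
    (hD : ∀ n ≥ n₀, D (x n) ∈ Submodule.span ℂ {x (n - 1), x n, x (n + 1)}) :
    ∃ p : Polynomial ℂ, 0 < p.natDegree ∧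
      ∀ (f : ℂ[T;T⁻¹]) (i : ℤ), (D f).coeff i = p.eval (i : ℂ) * f.coeff i := by
  obtain ⟨P, ⟨m₀, hm₀⟩, hP⟩ := hDr.exists_symbol
  obtain ⟨N, hN⟩ := exists_map_mem_flag_succ hx hD
  -- For large `k`, `z⁻ᵏ` lies in a span with exponents `-k, …, k-1`, and the next one adds only
  -- `k`; so `D` cannot lower the exponent. Likewise `zᵏ` lies in the span with exponents `-k, …,
  -- k`, and the next adds only `-k-1`.
  have hzero : ∀ m, m ≠ 0 → P m = 0 := by
    intro m hm
    rcases lt_or_gt_of_ne hm with hneg | hpos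
    · have hc : (P m).comp (-Polynomial.X) = 0 := by
        by_contra hne
        obtain ⟨k, h1, h2⟩ := ((eventually_eval_natCast_ne_zero hne).and
          (eventually_ge_atTop (N + 1))).exists
        refine h1 ?_
        have hT : (LaurentPolynomial.T (-k) : ℂ[T;T⁻¹]) ∈ flag (2 * k) :=
          mem_flag_even.mpr fun i hi => by
            rw [LaurentPolynomial.T_apply, if_neg (by omega)]
        have h3 := mem_flag_odd.mp (hN (2 * k) (by omega) _ hT) (-k + m) (by omega)
        rw [hP] at h3
        simpa using h3
      have := congrArg (fun q : Polynomial ℂ => q.comp (-Polynomial.X)) hc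
      simpa [Polynomial.comp_assoc] using this
    · by_contra hne
      obtain ⟨k, h1, h2⟩ := ((eventually_eval_natCast_ne_zero hne).and
        (eventually_ge_atTop N)).exists
      refine h1 ?_
      have hT : (LaurentPolynomial.T k : ℂ[T;T⁻¹]) ∈ flag (2 * k + 1) :=
        mem_flag_odd.mpr fun i hi => by
          rw [LaurentPolynomial.T_apply, if_neg (by omega)]
      have h3 := (mem_flag_even (k := k + 1)).mp (hN (2 * k + 1) (by omega) _ hT) (k + m)
        (by push_cast; omega)
      rw [hP] at h3
      simpa using h3
  refine ⟨P 0, ?_, fun f i => ?_⟩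
  · have h0 : m₀ = 0 := by
      by_contra h
      rw [hzero m₀ h] at hm₀
      simp at hm₀
    rw [h0] at hm₀
    exact hr.trans (Polynomial.le_natDegree_of_ne_zero hm₀)
  · induction f using LaurentPolynomial.induction_on' with
    | add f g hf hg =>
      simp only [map_add, AddMonoidAlgebra.coeff_add, Finsupp.add_apply, hf, hg]
      ring
    | C_mul_T j a =>
      have h := hP j (i - j)
      rw [add_sub_cancel] at h
      rw [← LaurentPolynomial.smul_eq_C_mul, map_smul]
      simp only [AddMonoidAlgebra.coeff_smul, Finsupp.smul_apply, smul_eq_mul, h,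
        LaurentPolynomial.T_apply]
      by_cases hij : j = i
      · subst hij; simp [mul_comm]
      · rw [if_neg hij, hzero (i - j) (by omega)]; simp

lemma exists_two_term_relation (hx : IsOLP μ x) {p : Polynomial ℂ}
    (hp : ∀ (f : ℂ[T;T⁻¹]) (i : ℤ), (D f).coeff i = p.eval (i : ℂ) * f.coeff i)
    (hD : ∀ n ≥ n₀, D (x n) ∈ Submodule.span ℂ {x (n - 1), x n, x (n + 1)})
    {n : ℕ} (hn : n₀ ≤ n) :
    ∃ c : ℂ, ∀ i : ℤ, (p.eval (i : ℂ) - p.eval (cmvExp (n + 1) : ℂ)) *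
      (monicOLP x (n + 1)).coeff i = c * (monicOLP x n).coeff i := by
  obtain ⟨a, b, c, h⟩ := Submodule.mem_span_triple.mp (hD (n + 1) (by omega))
  rw [add_tsub_cancel_right] at h
  have hcoeff : ∀ i : ℤ, p.eval (i : ℂ) * (x (n + 1)).coeff i =
      a * (x n).coeff i + b * (x (n + 1)).coeff i + c * (x (n + 1 + 1)).coeff i := by
    intro i
    rw [← hp, ← h]
    simp
  have h2 := hcoeff (cmvExp (n + 1 + 1))
  rw [coeff_cmvExp_of_mem_flag le_rfl (hx.mem_flag (n + 1)),
    coeff_cmvExp_of_mem_flag (by omega) (hx.mem_flag n)] at h2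
  -- A diagonal `D` creates no new exponent, so `D xₙ₊₁` has no `xₙ₊₂` component; the leading
  -- coefficient then fixes `b`.
  have hc : c = 0 := by
    simpa [hx.lead_ne_zero] using h2.symm
  have h1 := hcoeff (cmvExp (n + 1))
  rw [hc, coeff_cmvExp_of_mem_flag le_rfl (hx.mem_flag n), mul_zero, zero_add, zero_mul,
    add_zero] at h1
  have hb := mul_right_cancel₀ (hx.lead_ne_zero (n + 1)) h1
  have hl := hx.lead_ne_zero n
  refine ⟨a * (x n).coeff (cmvExp n) * ((x (n + 1)).coeff (cmvExp (n + 1)))⁻¹, fun i => ?_⟩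
  have h0 := hcoeff i
  rw [hc, ← hb] at h0
  simp only [monicOLP, AddMonoidAlgebra.coeff_smul, Finsupp.smul_apply, smul_eq_mul]
  have e : (x n).coeff (cmvExp n) * ((x n).coeff (cmvExp n))⁻¹ = 1 := mul_inv_cancel₀ hl
  linear_combination ((x (n + 1)).coeff (cmvExp (n + 1)))⁻¹ * h0
    - a * ((x (n + 1)).coeff (cmvExp (n + 1)))⁻¹ * (x n).coeff i * e

lemma isBispectralArray (hx : IsOLP μ x) {p : Polynomial ℂ}
    (hp : ∀ (f : ℂ[T;T⁻¹]) (i : ℤ), (D f).coeff i = p.eval (i : ℂ) * f.coeff i)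
    (hD : ∀ n ≥ n₀, D (x n) ∈ Submodule.span ℂ {x (n - 1), x n, x (n + 1)}) :
    IsBispectralArray p n₀ (szegoArray x) where
  odd k hk j := by
    obtain ⟨c, hc⟩ := exists_two_term_relation hx hp hD (n := 2 * k) (by omega)
    -- The unknown `c` is eliminated by evaluating the same relation at the leading exponent `k` of
    -- `χ₂ₖ`.
    have h1 := congrArg conj (hc (k - j))
    have h0 := hc k
    have hl := coeff_monicOLP hx (2 * k)
    rw [cmvExp_even] at hl
    rw [hl, mul_one] at h0
    rw [← h0] at h1
    rw [szegoArray_odd, szegoArray_odd, szegoArray_even, sub_zero]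
    have e : (2 * (k : ℤ) - j - k) = k - j := by ring
    rw [e]
    rw [cmvExp_odd] at h1
    push_cast at h1
    simp only [map_mul] at h1 ⊢
    linear_combination h1
  even k hk j := by
    obtain ⟨c, hc⟩ := exists_two_term_relation hx hp hD (n := 2 * k + 1) (by omega)
    have h1 := hc (j - k - 1)
    have h0 := hc (-k - 1)
    have hl := coeff_monicOLP hx (2 * k + 1)
    rw [cmvExp_odd] at hl
    rw [hl, mul_one] at h0
    rw [← h0] at h1
    rw [szegoArray_even_succ, szegoArray_even_succ, szegoArray_odd, Complex.conj_conj]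
    have e : ((k : ℤ) - (2 * k + 1 - j)) = j - k - 1 := by ring
    have e2 : cmvExp (2 * k + 1 + 1) = k + 1 := cmvExp_even (k + 1)
    rw [e, zero_sub]
    rw [e2] at h1
    push_cast at h1
    linear_combination h1

/-- Bispectral orthonormal Laurent polynomials are multiples of the powers of `z`. -/
theorem eq_smul_T_of_bispectral (hx : IsOLP μ x) {r : ℕ} (hr : 1 ≤ r) (hDr : IsDiffOp r D)
    (hD : ∀ n ≥ n₀, D (x n) ∈ Submodule.span ℂ {x (n - 1), x n, x (n + 1)}) (n : ℕ) :
    x n = (x n).coeff (cmvExp n) • LaurentPolynomial.T (cmvExp n) := by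
  obtain ⟨p, hp, hpD⟩ := exists_diagonal_symbol hx hr hDr hD
  have hA := (isBispectralArray hx hpD hD).eq_ite (isSzegoArray hx) hp n
  have hX : monicOLP x n = LaurentPolynomial.T (cmvExp n) := by
    ext i
    rw [LaurentPolynomial.T_apply]
    obtain ⟨k, rfl | rfl⟩ := n.even_or_odd'
    · have h := hA (i + k)
      rw [szegoArray_even, add_sub_cancel_right] at h
      rw [h, cmvExp_even]
      refine if_congr ?_ rfl rfl
      push_cast; omega
    · have h := congrArg conj (hA (k - i))
      rw [szegoArray_odd, sub_sub_cancel, Complex.conj_conj] at h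
      rw [h, cmvExp_odd, apply_ite conj, map_one, map_zero]
      refine if_congr ?_ rfl rfl
      push_cast; omega
  rw [← hX, monicOLP, smul_smul, mul_inv_cancel₀ (hx.lead_ne_zero n), one_smul]

end Bispectral

/-! ### Lebesgue measure -/

instance isFiniteMeasure_lebesgueCircle : IsFiniteMeasure lebesgueCircle := by
  unfold lebesgueCircle
  have : IsFiniteMeasure (ENNReal.ofReal (2 * Real.pi)⁻¹ •
      (volume : Measure ℝ).restrict (Set.Ioc 0 (2 * Real.pi))) :=
    Measure.smul_finite _ ENNReal.ofReal_ne_top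
  infer_instance

lemma integral_zpow_lebesgueCircle (m : ℤ) :
    ∫ z : Circle, (z : ℂ) ^ m ∂lebesgueCircle = if m = 0 then 1 else 0 := by
  have hcont : Continuous fun z : Circle => (z : ℂ) ^ m :=
    (by fun_prop : Continuous fun z : Circle => (z : ℂ)).zpow₀ m fun z => Or.inl z.coe_ne_zero
  rw [lebesgueCircle, integral_map (by fun_prop) hcont.aestronglyMeasurable,
    integral_smul_measure, ← intervalIntegral.integral_of_le (by positivity)]
  have hpi : (Real.pi : ℂ) ≠ 0 := Complex.ofReal_ne_zero.mpr Real.pi_ne_zero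
  have he : ∀ t : ℝ, ((Circle.exp t : Circle) : ℂ) ^ m = Complex.exp ((m * Complex.I) * t) := by
    intro t
    rw [Circle.coe_exp, ← Complex.exp_int_mul]
    congr 1; ring
  simp only [he]
  rw [ENNReal.toReal_ofReal (by positivity)]
  split_ifs with h
  · subst h
    simp
    field_simp
  · rw [integral_exp_mul_complex (by simp [h])]
    have h1 : Complex.exp (m * Complex.I * (2 * Real.pi : ℝ)) = 1 := by
      rw [← Complex.exp_int_mul_two_pi_mul_I m]
      congr 1; push_cast; ring
    rw [h1]
    simp

lemma ip_lebesgueCircle_T (f : ℂ[T;T⁻¹]) (j : ℤ) :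
    ip lebesgueCircle (LaurentPolynomial.T j) f = f.coeff j := by
  induction f using LaurentPolynomial.induction_on' with
  | add f g hf hg => rw [map_add, hf, hg]; rfl
  | C_mul_T n a =>
    rw [← LaurentPolynomial.smul_eq_C_mul, map_smul, AddMonoidAlgebra.coeff_smul,
      Finsupp.smul_apply, LaurentPolynomial.T_apply, ip_apply]
    congr 1
    have : ∀ z : Circle, ev z.toUnits (LaurentPolynomial.T n) *
        conj (ev z.toUnits (LaurentPolynomial.T j)) = (z : ℂ) ^ (n - j) := by
      intro z
      rw [ev_T, ev_T, coe_toUnits, map_zpow₀, ← Circle.coe_inv_eq_conj, Circle.coe_inv, inv_zpow',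
        ← zpow_add₀ z.coe_ne_zero, sub_eq_add_neg]
    simp only [this, integral_zpow_lebesgueCircle]
    exact if_congr sub_eq_zero rfl rfl

lemma IsOLP.eq_smul_T {x : ℕ → ℂ[T;T⁻¹]} (hx : IsOLP lebesgueCircle x) (n : ℕ) :
    x n = (x n).coeff (cmvExp n) • LaurentPolynomial.T (cmvExp n) := by
  rw [← sub_eq_zero]
  refine hx.eq_zero_of_ip_eq_zero (n := n) (mem_flag_of_coeff_eq_zero
    (sub_mem (hx.mem_flag n) (Submodule.smul_mem _ _ (T_mem_flag n))) (by simp)) fun g hg => ?_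
  rw [ip_sub_right, ip_smul_right, hx.ip_eq_zero hg, ip_lebesgueCircle_T,
    coeff_cmvExp_of_mem_flag le_rfl hg, mul_zero, sub_zero]

lemma ip_T_self (μ : Measure Circle) [IsProbabilityMeasure μ] (j : ℤ) :
    ip μ (LaurentPolynomial.T j) (LaurentPolynomial.T j) = 1 := by
  have h := ip_mul_T μ 1 1 j
  rw [one_mul] at h
  rw [h, ip_apply]
  simp

/-- Since `|z| = 1`, every power has norm one for any probability measure; hence the scalars are
unimodular, and orthonormality passes to Lebesgue measure. -/
lemma isOLP_lebesgueCircle {μ : Measure Circle} [IsProbabilityMeasure μ] {x : ℕ → ℂ[T;T⁻¹]}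
    (hx : IsOLP μ x)
    (h : ∀ n, x n = (x n).coeff (cmvExp n) • LaurentPolynomial.T (cmvExp n)) :
    IsOLP lebesgueCircle x where
  mem_span := hx.mem_span
  orthonormal m n := by
    have h1 : conj ((x n).coeff (cmvExp n)) * (x n).coeff (cmvExp n) = 1 := by
      have h2 := hx.ip_eq n n
      rwa [h n, ip_smul_right, map_smul, ip_T_self, if_pos rfl, smul_eq_mul, mul_one] at h2
    change ip lebesgueCircle (x n) (x m) = _
    rw [h n, ip_smul_right, ip_lebesgueCircle_T]
    split_ifs with hmn
    · rw [hmn, h1]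
    · rw [h m]
      have : cmvExp m ≠ cmvExp n := cmvExp_injective.ne hmn
      simp [this]

end CMVBispectral

end

/-- Truncated subtraction turns `x (n - 1)` into `x 0` at `n = 0`. The span already contains `x 0`,
so this agrees with the convention `x₋₁ = 0`. -/
theorem mainTheorem2 (μ : MeasureTheory.Measure Circle) [MeasureTheory.IsProbabilityMeasure μ]
    (hμ : μ.support.Infinite)
    (x : ℕ → LaurentPolynomial ℂ) (hx : CMVBispectral.IsOLP μ x) :
    (∃ r : ℕ, 1 ≤ r ∧
      ∃ D : LaurentPolynomial ℂ →ₗ[ℂ] LaurentPolynomial ℂ, CMVBispectral.IsDiffOp r D ∧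
        ∃ n₀ : ℕ, ∀ n ≥ n₀, D (x n) ∈ Submodule.span ℂ {x (n - 1), x n, x (n + 1)}) ↔
      CMVBispectral.IsOLP CMVBispectral.lebesgueCircle x := by
  constructor
  · rintro ⟨r, hr, D, hDr, n₀, hD⟩
    exact CMVBispectral.isOLP_lebesgueCircle hx
      (CMVBispectral.eq_smul_T_of_bispectral hx hr hDr hD)
  · intro hL
    refine ⟨1, le_rfl, CMVBispectral.euler, CMVBispectral.isDiffOp_euler, 0, fun n _ => ?_⟩
    have h : CMVBispectral.euler (x n) = (CMVBispectral.cmvExp n : ℂ) • x n := by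
      rw [hL.eq_smul_T n, map_smul, CMVBispectral.euler_T, smul_comm]
    rw [h]
    exact Submodule.smul_mem _ _ (Submodule.subset_span (by simp))
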